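/- Let $K$ be a field and let $\mathcal O\subseteq K$ be either the interval $[-1,1]$ of a total order making $K$ an ordered field, or the ring of a non-trivial valuation of $K$. For $x,y\in K$ write $|y|\le|x|$ if $y\in x\mathcal O$, and $|y|<|x|$ if $|x|\not\le|y|$. Give $K$ the topology whose basic open sets are the open balls $\{x:|x-c|<|r|\}$ ($c\in K$, $r\in K^\times$), and $K^m$ the product topology. Let $\mathcal K$ be an expansion of $(K,+,\times,\mathcal O)$ to a first-order language $\mathcal L$; "definable" means definable in $\mathcal K$ with parameters from $K$. Assume (BFin) every definable subset of $K$ that is closed, bounded and discrete is finite. For a definable set $Y\subseteq K^m$ let $\mathcal C(Y)$ be the ring of continuous definable functions $Y\to K$. Let $X\subseteq K^m$ be a definable set and $\mathcal B=\{s\in\mathcal C(X): s(x)\in\mathcal O\text{ for all }x\in X\}$. We say that $X$ has *arbitrarily many germs* at $p_0\in X$ if for every integer $k\ge1$ there are a definable neighbourhood $U$ of $p_0$ in $X$, functions $s_1,\dots,s_k\in\mathcal C(U)$ and functions $\delta_1,\dots,\delta_k\in\mathcal C(U\setminus\{p_0\})$ such that, with $S_i=\{x\in U\setminus\{p_0\}:s_i(x)=0\}$: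 the sets $S_i$ are pairwise disjoint; $s_i(p_0)=0$ and $p_0\in\overline{S_i}$ for each $i$; for $i\ne j$, $\delta_i$ is constantly $1$ on $S_i$ and constantly $0$ on $S_j$; and each $\delta_i$ is bounded on $U\setminus\{p_0\}$. **Corollary.** Suppose that $\mathcal K$ satisfies (BFin), let $\tau\in K^\times$ with $|\tau|<|1|$, and suppose that $X$ has arbitrarily many germs at a point $p_0\in X$. Let $p,\tau^*\in\mathcal C(X)$ be such that $p_0$ is the unique zero of $p$ and $\tau^*(p_0)=\tau$. Then the ring of integers $(\mathbb Z,+,\times)$ is interpretable in $(\mathcal C(X),\mathcal B)$, that is, in the ring $\mathcal C(X)$ expanded by a unary predicate for $\mathcal B$, with parameters $(p,\tau^*)$: there are $k\in\mathbb N$, a set $D\subseteq\mathcal C(X)^k$ and a surjection $\pi:D\to\mathbb Z$ such that $D$ and the preimages under $\pi$ of equality and of the graphs of the ring operations and constants of $\mathbb Z$ are first-order definable in $(\mathcal C(X),\mathcal B)$ with parameters $p,\tau^*$. -/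

import Mathlib

universe u v w



noncomputable section

namespace DefContFun

/-! ### The language of rings with one unary predicate -/

/-- The relation symbols of the language of rings with one unary predicate. -/
inductive PredRel : ℕ → Type
  | pred : PredRel 1

/-- The language of rings together with one unary predicate symbol. -/
def ringPred : FirstOrder.Language.{0, 0} where
  Functions := FirstOrder.ringFunc
  Relations := PredRel

/-- A ring with a distinguished subset `P`, as a structure in the language `ringPred`. -/
abbrev ringPredStructure (R : Type u) [Ring R] (P : Set R) : ringPred.Structure R where
  funMap := fun {n} f => (FirstOrder.Ring.compatibleRingOfRing R).funMap (n := n) f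
  RelMap := fun {_} r =>
    match r with
    | .pred => fun x => x 0 ∈ P

/-- The ring of integers as a structure in the language of rings. -/
instance intRingStructure : FirstOrder.Language.ring.Structure ℤ :=
  (FirstOrder.Ring.compatibleRingOfRing ℤ).toStructure

/-! ### Interpretations -/

section Interpretation

variable {M : Type u} {N : Type v}

/-- The preimage of `S ⊆ N ^ n` under the coordinate map `π : D → N`, where `D ⊆ M ^ k`,
as a subset of `M ^ (n * k)`. -/
def pullback {k : ℕ} {D : Set (Fin k → M)} (π : D → N) {n : ℕ} (S : Set (Fin n → N)) :
    Set (Fin n × Fin k → M) :=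
  {z | ∃ d : Fin n → D, (∀ i j, z (i, j) = (d i : Fin k → M) j) ∧ (fun i => π (d i)) ∈ S}

/-- The structure `N` is interpretable in the structure `M` with parameters in `A`: there are a set
`D ⊆ M ^ k` definable over `A` and a surjection `π : D → N` such that the preimages under `π` of
equality, of the graphs of all basic functions and of all basic relations of `N` are definable
over `A`. (Thus `π` identifies `N` with the quotient of `D` by a definable equivalence
relation.) -/
def IsInterpretable (L : FirstOrder.Language) (M : Type u) [L.Structure M] (A : Set M)
    (L' : FirstOrder.Language) (N : Type v) [L'.Structure N] : Prop :=
  ∃ (k : ℕ) (D : Set (Fin k → M)) (π : D → N),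
    Function.Surjective π ∧
    A.Definable L D ∧
    A.Definable L (pullback π {y : Fin 2 → N | y 0 = y 1}) ∧
    (∀ (n : ℕ) (f : L'.Functions n), A.Definable L
      (pullback π {y : Fin (n + 1) → N |
        y (Fin.last n) = FirstOrder.Language.Structure.funMap f (fun i => y (Fin.castSucc i))})) ∧
    (∀ (n : ℕ) (r : L'.Relations n), A.Definable L
      (pullback π {y : Fin n → N | FirstOrder.Language.Structure.RelMap r y}))

end Interpretation

/-! ### Ordered and valued fields -/

/-- `|y| ≤ |x|` with respect to `O`, that is, `y ∈ x * O`. -/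
def AbsLE {K : Type u} [Field K] (O : Set K) (y x : K) : Prop := ∃ a ∈ O, y = x * a

/-- `|y| < |x|` with respect to `O`. (The values `|x|` are totally ordered.) -/
def AbsLT {K : Type u} [Field K] (O : Set K) (y x : K) : Prop := ¬ AbsLE O x y

/-- A field `K` together with a set `unitBall ⊆ K` which is either the interval `[-1, 1]` of a total
order making `K` an ordered field, or the ring of a non-trivial valuation of `K`, endowed with the
topology given by the open balls `{x | |x - c| < |r|}` with `r ≠ 0`. -/
class OrderedOrValuedField (K : Type u) [Field K] [TopologicalSpace K] where
  unitBall : Set K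
  unitBall_spec :
    (∃ _ : LinearOrder K, IsStrictOrderedRing K ∧ unitBall = Set.Icc (-1) 1) ∨
    (∃ V : ValuationSubring K, V ≠ ⊤ ∧ unitBall = (V : Set K))
  nhds_hasBasis : ∀ c : K,
    (nhds c).HasBasis (fun r : K => r ≠ 0) (fun r => {x | AbsLT unitBall (x - c) r})


open OrderedOrValuedField (unitBall)

section Field

variable {K : Type u} [Field K] [TopologicalSpace K] [OrderedOrValuedField K]

theorem absLT_cases :
    (∃ (_ : LinearOrder K) (_ : IsStrictOrderedRing K),
      ∀ y x : K, AbsLT (unitBall (K := K)) y x ↔ |y| < |x|) ∨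
    (∃ V : ValuationSubring K,
      ∀ y x : K, AbsLT (unitBall (K := K)) y x ↔ V.valuation y < V.valuation x) := by
  rcases OrderedOrValuedField.unitBall_spec (K := K) with ⟨lo, so, h⟩ | ⟨V, -, h⟩
  · refine Or.inl ⟨lo, so, fun y x => ?_⟩
    rw [AbsLT, ← not_le, not_iff_not, AbsLE, h]
    constructor
    · rintro ⟨a, ha, rfl⟩
      rw [abs_mul]
      exact mul_le_of_le_one_right (abs_nonneg _) (abs_le.2 ha)
    · intro hxy
      by_cases hy : y = 0
      · refine ⟨0, by simp, ?_⟩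
        rw [hy, abs_zero] at hxy
        simpa using hxy
      · refine ⟨x / y, ?_, by field_simp⟩
        rw [Set.mem_Icc, ← abs_le, abs_div]
        exact div_le_one_of_le₀ hxy (abs_nonneg _)
  · refine Or.inr ⟨V, fun y x => ?_⟩
    rw [AbsLT, ← not_le, not_iff_not, V.valuation_le_iff, AbsLE, h]
    constructor
    · rintro ⟨a, ha, rfl⟩
      exact ⟨⟨a, ha⟩, mul_comm _ _⟩
    · rintro ⟨a, rfl⟩
      exact ⟨a, a.2, mul_comm _ _⟩

instance isTopologicalRing : IsTopologicalRing K := by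
  rcases absLT_cases (K := K) with ⟨lo, so, h⟩ | ⟨V, h⟩
  · have hb : ∀ c : K, (nhds c).HasBasis (fun r : K => 0 < r) (fun r => {x | |x - c| < r}) := by
      intro c
      refine (OrderedOrValuedField.nhds_hasBasis c).to_hasBasis ?_ ?_
      · intro r hr
        exact ⟨|r|, abs_pos.2 hr, fun x hx => (h _ _).2 hx⟩
      · intro r hr
        exact ⟨r, hr.ne', fun x hx => by simpa [abs_of_pos hr] using (h _ _).1 hx⟩
    have : OrderTopology K := by
      constructor
      refine TopologicalSpace.ext_nhds fun c => ?_
      let := Preorder.topology K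
      have : OrderTopology K := ⟨rfl⟩
      exact (hb c).eq_of_same_basis (nhds_basis_abs_sub_lt c)
    infer_instance
  · have hb : ∀ c : K, (nhds c).HasBasis (fun r : K => r ≠ 0)
        (fun r => {x | V.valuation (x - c) < V.valuation r}) := by
      intro c
      simpa only [h] using OrderedOrValuedField.nhds_hasBasis c
    have hadd : ContinuousAdd K := by
      refine ⟨continuous_iff_continuousAt.2 fun ⟨a, b⟩ => ?_⟩
      rw [ContinuousAt, nhds_prod_eq, ((hb a).prod (hb b)).tendsto_iff (hb (a + b))]
      intro r hr
      refine ⟨(r, r), ⟨hr, hr⟩, fun ⟨x, y⟩ ⟨hx, hy⟩ => ?_⟩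
      have e : x + y - (a + b) = (x - a) + (y - b) := by ring
      simp only [Set.mem_ofPred_eq] at hx hy ⊢
      rw [e]
      exact V.valuation.map_add_lt hx hy
    have hmul : ContinuousMul K := by
      refine ⟨continuous_iff_continuousAt.2 fun ⟨a, b⟩ => ?_⟩
      rw [ContinuousAt, nhds_prod_eq, ((hb a).prod (hb b)).tendsto_iff (hb (a * b))]
      intro r hr
      have key : ∀ c : K, ∃ s : K, s ≠ 0 ∧ V.valuation s ≤ 1 ∧
          V.valuation s * V.valuation c ≤ V.valuation r := by
        intro c
        obtain ⟨t, ht, ht1⟩ : ∃ t : K, t ≠ 0 ∧ V.valuation t * V.valuation c ≤ V.valuation r := by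
          by_cases hc : c = 0
          · exact ⟨1, one_ne_zero, by simp [hc]⟩
          · refine ⟨r / c, div_ne_zero hr hc, ?_⟩
            rw [← map_mul, div_mul_cancel₀ _ hc]
        rcases le_total (V.valuation t) 1 with h1 | h1
        · exact ⟨t, ht, h1, ht1⟩
        · refine ⟨1, one_ne_zero, by simp, le_trans ?_ ht1⟩
          rw [map_one]
          gcongr
      obtain ⟨s, hs, hs1, hsb⟩ := key b
      obtain ⟨t, ht, ht1, hta⟩ := key a
      obtain ⟨q, hq, hq1, hqr⟩ := key 1
      rw [map_one, mul_one] at hqr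
      refine ⟨(s, t * q), ⟨hs, mul_ne_zero ht hq⟩, fun ⟨x, y⟩ ⟨hx, hy⟩ => ?_⟩
      have e : x * y - a * b = (x - a) * (y - b) + ((x - a) * b + a * (y - b)) := by ring
      simp only [Set.mem_ofPred_eq, map_mul] at hx hy ⊢
      have hr' : 0 < V.valuation r := (Valuation.pos_iff _).2 hr
      have hq0 : 0 < V.valuation q := (Valuation.pos_iff _).2 hq
      have ht0 : 0 < V.valuation t := (Valuation.pos_iff _).2 ht
      have hyq : V.valuation (y - b) < V.valuation q :=
        hy.trans_le (mul_le_of_le_one_left' ht1)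
      have hyt : V.valuation (y - b) < V.valuation t :=
        hy.trans_le (mul_le_of_le_one_right' hq1)
      rw [e]
      refine V.valuation.map_add_lt ?_ (V.valuation.map_add_lt ?_ ?_)
      · rw [map_mul]
        calc _ ≤ 1 * V.valuation (y - b) := by gcongr; exact hx.le.trans hs1
          _ < V.valuation r := by rw [one_mul]; exact hyq.trans_le hqr
      · rw [map_mul]
        by_cases hb0 : b = 0
        · simpa [hb0] using hr'
        · refine lt_of_lt_of_le ?_ hsb
          exact mul_lt_mul_of_pos_right hx ((Valuation.pos_iff _).2 hb0)
      · rw [map_mul, mul_comm]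
        by_cases ha0 : a = 0
        · simpa [ha0] using hr'
        · refine lt_of_lt_of_le ?_ hta
          exact mul_lt_mul_of_pos_right hyt ((Valuation.pos_iff _).2 ha0)
    have hneg : ContinuousNeg K := by
      refine ⟨?_⟩
      have e : (fun x : K => -x) = fun x => (-1) * x := by ext; simp
      rw [e]
      exact continuous_const.mul continuous_id
    exact { hadd, hmul, hneg with }

end Field

/-! ### Definable sets and continuous definable functions -/

section Definable

variable (L : FirstOrder.Language.{v, w}) {K : Type u} [L.Structure K]

/-- A map `f : X → K`, `X ⊆ K ^ m`, is definable (with parameters) if its graph is. -/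
def IsDefinableFun {m : ℕ} {X : Set (Fin m → K)} (f : X → K) : Prop :=
  (Set.univ : Set K).Definable L
    {z : Fin (m + 1) → K | ∃ x : X, z = Fin.snoc (α := fun _ => K) (x : Fin m → K) (f x)}

variable {L}

theorem isDefinableFun_funMap {m n : ℕ} {X : Set (Fin m → K)}
    (hX : (Set.univ : Set K).Definable L X) (F : L.Functions n) (g : Fin n → X → K)
    (hg : ∀ i, IsDefinableFun L (g i)) :
    IsDefinableFun L (fun x => FirstOrder.Language.Structure.funMap F (fun i => g i x)) := by
  have hF : (Set.univ : Set K).Definable L {v : Fin (m + 1) ⊕ Fin n → K |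
      v (Sum.inl (Fin.last m)) = FirstOrder.Language.Structure.funMap F (fun i => v (Sum.inr i))} := by
    refine Set.Definable.mono (Set.empty_definable_iff.2 ⟨FirstOrder.Language.Term.equal
      (FirstOrder.Language.Term.var (Sum.inl (Fin.last m)))
      (FirstOrder.Language.Term.func F (fun i => FirstOrder.Language.Term.var (Sum.inr i))), ?_⟩) (Set.subset_univ _)
    ext v
    simp [FirstOrder.Language.Formula.realize_equal]
  have hG : ∀ i : Fin n, (Set.univ : Set K).Definable L _ := fun i =>
    (hg i).preimage_comp (β := Fin (m + 1) ⊕ Fin n)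
      (Fin.snoc (α := fun _ => Fin (m + 1) ⊕ Fin n) (fun j => Sum.inl j.castSucc) (Sum.inr i))
  have h := ((hX.preimage_comp (β := Fin (m + 1) ⊕ Fin n)
    (fun j => Sum.inl j.castSucc)).inter
      ((Set.definable_iInter_of_finite hG).inter hF)).exists_of_finite
  unfold IsDefinableFun
  convert h using 1
  have hs : ∀ (z : Fin (m + 1) → K) (u : Fin n → K) (i : Fin n), Sum.elim z u ∘
      (Fin.snoc (α := fun _ => Fin (m + 1) ⊕ Fin n) (fun j => Sum.inl j.castSucc) (Sum.inr i)) =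
      Fin.snoc (α := fun _ => K) (fun j => z j.castSucc) (u i) := by
    intro z u i
    ext j
    refine Fin.lastCases ?_ (fun j => ?_) j <;> simp
  ext z
  simp only [Set.mem_ofPred_eq, Set.mem_inter_iff, Set.mem_preimage, Set.mem_iInter, hs,
    Sum.elim_inl, Sum.elim_inr]
  constructor
  · rintro ⟨x, rfl⟩
    refine ⟨fun i => g i x, ?_, fun i => ⟨x, ?_⟩, by simp⟩
    · convert x.2 using 1
      ext j
      simp
    · congr 1
      ext j
      simp
  · rintro ⟨u, hx, hu, hz⟩
    refine ⟨⟨_, hx⟩, ?_⟩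
    ext j
    refine Fin.lastCases ?_ (fun j => ?_) j
    · rw [hz]
      simp only [Fin.snoc_last]
      congr 1
      ext i
      obtain ⟨y, hy⟩ := hu i
      have h1 := congrFun hy (Fin.last m)
      simp only [Fin.snoc_last] at h1
      rw [h1]
      congr 1
      ext j
      have h2 := congrFun hy j.castSucc
      simpa using h2.symm
    · simp

end Definable

section Ring

variable (L : FirstOrder.Language.{v, w}) (K : Type u) [Field K] [TopologicalSpace K]
  [OrderedOrValuedField K] [L.Structure K]

/-- The `L`-structure `K` is an expansion of the ordered or valued field `(K, unitBall)`: the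
language `L` has symbols for the ring operations and for `unitBall`, interpreted as such. -/
class IsExpansion : Prop where
  exists_hom : ∃ ι : ringPred →ᴸ L,
    letI := ringPredStructure K (unitBall (K := K))
    ι.IsExpansionOn K

/-- Every definable subset of `K` that is closed, bounded and discrete is finite. -/
def BFin : Prop :=
  ∀ S : Set K, (Set.univ : Set K).Definable₁ L S → IsClosed S →
    (∃ r : K, ∀ x ∈ S, AbsLE unitBall x r) → IsDiscrete S → S.Finite

variable {K} {m : ℕ}

/-- Continuous definable functions `X → K`. -/
def IsContDef {X : Set (Fin m → K)} (f : X → K) : Prop := Continuous f ∧ IsDefinableFun L f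

variable {L}

theorem exists_symbol [IsExpansion L K] {n : ℕ} (f : FirstOrder.Language.ring.Functions n) :
    ∃ F : L.Functions n, ∀ x : Fin n → K,
      FirstOrder.Language.Structure.funMap F x = (FirstOrder.Ring.compatibleRingOfRing K).funMap f x := by
  obtain ⟨ι, hι⟩ := IsExpansion.exists_hom (L := L) (K := K)
  letI := ringPredStructure K (unitBall (K := K))
  exact ⟨ι.onFunction (n := n) f, fun x => hι.map_onFunction (n := n) f x⟩

variable (L)

/-- The ring `C(X)` of continuous definable functions `X → K`. -/
def contDefRing [IsExpansion L K] {X : Set (Fin m → K)}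
    (hX : (Set.univ : Set K).Definable L X) : Subring (X → K) where
  carrier := {f | IsContDef L f}
  zero_mem' := by
    obtain ⟨F, hF⟩ := exists_symbol (L := L) (K := K) FirstOrder.Ring.zeroFunc
    refine ⟨continuous_const, ?_⟩
    convert isDefinableFun_funMap hX F ![] (fun i => i.elim0) using 2
    rw [hF]; rfl
  one_mem' := by
    obtain ⟨F, hF⟩ := exists_symbol (L := L) (K := K) FirstOrder.Ring.oneFunc
    refine ⟨continuous_const, ?_⟩
    convert isDefinableFun_funMap hX F ![] (fun i => i.elim0) using 2
    rw [hF]; rfl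
  add_mem' := by
    rintro f g ⟨hf, hf'⟩ ⟨hg, hg'⟩
    obtain ⟨F, hF⟩ := exists_symbol (L := L) (K := K) FirstOrder.Ring.addFunc
    refine ⟨hf.add hg, ?_⟩
    convert isDefinableFun_funMap hX F ![f, g] (by simp [Fin.forall_fin_two, hf', hg']) using 2
    rw [hF]; rfl
  mul_mem' := by
    rintro f g ⟨hf, hf'⟩ ⟨hg, hg'⟩
    obtain ⟨F, hF⟩ := exists_symbol (L := L) (K := K) FirstOrder.Ring.mulFunc
    refine ⟨hf.mul hg, ?_⟩
    convert isDefinableFun_funMap hX F ![f, g] (by simp [Fin.forall_fin_two, hf', hg']) using 2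
    rw [hF]; rfl
  neg_mem' := by
    rintro f ⟨hf, hf'⟩
    obtain ⟨F, hF⟩ := exists_symbol (L := L) (K := K) FirstOrder.Ring.negFunc
    refine ⟨hf.neg, ?_⟩
    convert isDefinableFun_funMap hX F ![f] (by simp [hf']) using 2
    rw [hF]; rfl

/-- The structure `(C(X), B)`, where `B` is the set of functions with values in the unit ball. -/
instance contDefStructure [IsExpansion L K] {X : Set (Fin m → K)}
    (hX : (Set.univ : Set K).Definable L X) : ringPred.Structure (contDefRing L hX) :=
  ringPredStructure (contDefRing L hX) {s | ∀ x : X, (s : X → K) x ∈ unitBall (K := K)}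

/-! ### Germs -/

/-- `s : U → K` has a non-isolated zero at `p₀`. -/
def VanishesOnGerm {U : Set (Fin m → K)} (s : U → K) (p₀ : Fin m → K) : Prop :=
  (∃ h : p₀ ∈ U, s ⟨p₀, h⟩ = 0) ∧
  p₀ ∈ closure {x | x ≠ p₀ ∧ ∃ h : x ∈ U, s ⟨x, h⟩ = 0}

/-- The functions `s₁, …, s_k : U → K` vanish on separated germs at `p₀`. -/
def VanishOnSeparatedGerms {U : Set (Fin m → K)} {k : ℕ} (s : Fin k → U → K)
    (p₀ : Fin m → K) : Prop :=
  ∃ δ : Fin k → ↥(U \ {p₀}) → K,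
    (∀ i, IsContDef L (δ i)) ∧
    (∀ i j, i ≠ j → ∀ x : U, (x : Fin m → K) ≠ p₀ → ¬ (s i x = 0 ∧ s j x = 0)) ∧
    (∀ i, VanishesOnGerm (s i) p₀) ∧
    (∀ i j, i ≠ j → ∀ x : ↥(U \ {p₀}),
      (s i ⟨x, x.2.1⟩ = 0 → δ i x = 1) ∧ (s j ⟨x, x.2.1⟩ = 0 → δ i x = 0)) ∧
    (∀ i, ∃ r : K, ∀ x, AbsLE unitBall (δ i x) r)

/-- `X` has arbitrarily many germs at `p₀ ∈ X`: for every positive `k` there are a definable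
neighbourhood `U` of `p₀` in `X` and `k` continuous definable functions on `U` that vanish on
separated germs at `p₀`. -/
def HasArbitrarilyManyGerms (X : Set (Fin m → K)) (p₀ : Fin m → K) : Prop :=
  ∀ k : ℕ, 0 < k → ∃ U : Set (Fin m → K), U ⊆ X ∧ (Set.univ : Set K).Definable L U ∧
    U ∈ nhdsWithin p₀ X ∧
    ∃ s : Fin k → U → K, (∀ i, IsContDef L (s i)) ∧ VanishOnSeparatedGerms L s p₀

end Ring

end DefContFun

end

/-! The value of a function at `p₀` is accessible to the ring: `a` and `b` agree at `p₀` exactly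
when `a - b` and `p` have a common zero. By a weak Nullstellensatz (`exists_eq_one_iff`,
`exists_eq_one_iff₃`) this means that they do not generate the unit ideal. Constants realise every
value, so quantifying over the ring amounts to quantifying over `K`.

The next step is to quantify over finite subsets of `K`. A pair `(f, s)` codes the set of cluster
values of `f / p` at `p₀` along the zeros of `s`. Such a set is closed and definable in `K`
(`definable_clusterSet`), and membership in it is first-order in `(C(X), B)` (`clusters_iff`). So is
being bounded and discrete (`boundedDiscrete_iff`), which forces finiteness by (BFin). Conversely,
separated germs realise every nonempty finite set (`exists_clusterSet_eq_range`): the `δᵢ` may jump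
at `p₀`, but being bounded they extend continuously after multiplication by `p`. This is why
quotients by `p` are used.

With finite sets available, powers of an element `τ` with `0 < |τ| < 1` are definable
(`isPower_iff`). A nonzero `x` is a power of `τ` iff it lies in a coded finite set in which every
element is `1` or `τ` times another element; otherwise `x, x/τ, x/τ², …` would be infinitely many
elements of it.

The integer `n` is represented by a function with value `τ ^ n` at `p₀`; the exponent is unique
since `|τ| < 1`. Addition becomes multiplication of values. The same formula with base `τ ^ n`, `n >
0`, expresses divisibility of natural exponents by `n`. Multiplication follows by Robinson's method:
for `a > 0`, `a(a+1)` is the least common multiple of the coprime numbers `a` and `a+1`, and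
`(a+b)(a+b+1) = a(a+1) + b(b+1) + 2ab`. -/

noncomputable section

open Set FirstOrder Filter Topology

namespace DefContFun

open OrderedOrValuedField (unitBall)

/-! ### Definable predicates -/

section Toolkit

variable (L : FirstOrder.Language.{v, w}) {M : Type u} [L.Structure M] (A : Set M)
variable {α β : Type}

/-- A predicate on tuples is definable if the set of tuples satisfying it is. -/
def DefinablePred (P : (α → M) → Prop) : Prop := A.Definable L {v | P v}

variable {L A}

theorem DefinablePred.and {P Q : (α → M) → Prop} (hP : DefinablePred L A P)
    (hQ : DefinablePred L A Q) : DefinablePred L A (fun v => P v ∧ Q v) :=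
  Definable.inter hP hQ

theorem DefinablePred.or {P Q : (α → M) → Prop} (hP : DefinablePred L A P)
    (hQ : DefinablePred L A Q) : DefinablePred L A (fun v => P v ∨ Q v) :=
  Definable.union hP hQ

theorem DefinablePred.not {P : (α → M) → Prop} (hP : DefinablePred L A P) :
    DefinablePred L A (fun v => ¬ P v) :=
  Definable.compl hP

theorem DefinablePred.congr {P Q : (α → M) → Prop} (hP : DefinablePred L A P)
    (h : ∀ v, Q v ↔ P v) : DefinablePred L A Q := by
  have : Q = P := funext fun v => propext (h v)
  rwa [this]

theorem DefinablePred.imp {P Q : (α → M) → Prop} (hP : DefinablePred L A P)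
    (hQ : DefinablePred L A Q) : DefinablePred L A (fun v => P v → Q v) :=
  (hP.not.or hQ).congr fun _ => imp_iff_not_or

theorem DefinablePred.forall_fin {ι : Type} [Finite ι] {P : ι → (α → M) → Prop}
    (hP : ∀ i, DefinablePred L A (P i)) : DefinablePred L A (fun v => ∀ i, P i v) := by
  have := definable_iInter_of_finite hP
  unfold DefinablePred
  convert this using 1
  ext v
  simp

theorem DefinablePred.exists_tuple [Finite β] {P : (α → M) → (β → M) → Prop}
    (hP : DefinablePred L A (fun w : α ⊕ β → M => P (fun a => w (.inl a)) (fun b => w (.inr b)))) :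
    DefinablePred L A (fun v => ∃ u, P v u) :=
  Definable.exists_of_finite hP

theorem DefinablePred.forall_tuple [Finite β] {P : (α → M) → (β → M) → Prop}
    (hP : DefinablePred L A (fun w : α ⊕ β → M => P (fun a => w (.inl a)) (fun b => w (.inr b)))) :
    DefinablePred L A (fun v => ∀ u, P v u) :=
  Definable.forall_of_finite hP

theorem DefinablePred.exists {P : (α → M) → M → Prop}
    (hP : DefinablePred L A (fun w : α ⊕ Unit → M => P (fun a => w (.inl a)) (w (.inr ())))) :
    DefinablePred L A (fun v => ∃ y, P v y) :=
  (DefinablePred.exists_tuple (β := Unit) (P := fun v u => P v (u ())) hP).congr fun _ =>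
    ⟨fun ⟨y, hy⟩ => ⟨fun _ => y, hy⟩, fun ⟨u, hu⟩ => ⟨u (), hu⟩⟩

theorem DefinablePred.forall {P : (α → M) → M → Prop}
    (hP : DefinablePred L A (fun w : α ⊕ Unit → M => P (fun a => w (.inl a)) (w (.inr ())))) :
    DefinablePred L A (fun v => ∀ y, P v y) :=
  (DefinablePred.forall_tuple (β := Unit) (P := fun v u => P v (u ())) hP).congr fun _ =>
    ⟨fun h u => h (u ()), fun h y => h fun _ => y⟩

theorem DefinablePred.eq {f g : (α → M) → M} (hf : A.DefinableFun L f) (hg : A.DefinableFun L g) :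
    DefinablePred L A (fun v => f v = g v) :=
  hf.ofPred_eq hg

theorem DefinablePred.subst [Finite β] {P : (β → M) → Prop} (hP : DefinablePred L A P)
    {t : β → (α → M) → M} (ht : ∀ b, A.DefinableFun L (t b)) :
    DefinablePred L A (fun v => P (fun b => t b v)) :=
  Definable.preimage_map (F := fun v b => t b v) ht hP

theorem _root_.Set.DefinableFun.subst [Finite β] {G : (β → M) → M} (hG : A.DefinableFun L G)
    {t : β → (α → M) → M} (ht : ∀ b, A.DefinableFun L (t b)) :
    A.DefinableFun L (fun v => G (fun b => t b v)) :=
  DefinableFun.comp (g := fun v b => t b v) ht hG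

theorem _root_.Set.DefinableFun.relabel {G : (β → M) → M} (hG : A.DefinableFun L G)
    (e : β → α) : A.DefinableFun L (fun v => G (fun b => v (e b))) := by
  have := Definable.preimage_comp (fun o : Option β => o.map e) hG
  exact this

theorem definableFun_of_pred {G : (α → M) → M}
    (h : DefinablePred L A (fun w : Option α → M => G (fun a => w (some a)) = w none)) :
    A.DefinableFun L G := h

end Toolkit

/-! ### Definability in the field -/

section FieldDefinable

theorem definableFun_const {L : FirstOrder.Language.{v, w}} {K : Type u} [L.Structure K]
    {α : Type} (c : K) : (univ : Set K).DefinableFun L (fun _ : α → K => c) :=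
  L.definableFun_const α (mem_univ c)

variable {L : FirstOrder.Language.{v, w}} {K : Type u} [Field K] [TopologicalSpace K]
  [OrderedOrValuedField K] [L.Structure K] [IsExpansion L K] {α : Type}

theorem definableFun_ringSymbol {n : ℕ} (F : Language.ring.Functions n)
    {t : Fin n → (α → K) → K} (ht : ∀ i, (univ : Set K).DefinableFun L (t i)) :
    (univ : Set K).DefinableFun L
      (fun v => (Ring.compatibleRingOfRing K).funMap F (fun i => t i v)) := by
  obtain ⟨G, hG⟩ := exists_symbol (L := L) (K := K) F
  simp_rw [← hG]
  exact (DefinableFun.of_empty (DefinableFun.fun_symbol G)).subst ht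

variable {f g : (α → K) → K}

theorem _root_.Set.DefinableFun.add (hf : (univ : Set K).DefinableFun L f)
    (hg : (univ : Set K).DefinableFun L g) :
    (univ : Set K).DefinableFun L (fun v => f v + g v) :=
  definableFun_ringSymbol (t := ![f, g]) Ring.addFunc (by simp [Fin.forall_fin_two, hf, hg])

theorem _root_.Set.DefinableFun.mul (hf : (univ : Set K).DefinableFun L f)
    (hg : (univ : Set K).DefinableFun L g) :
    (univ : Set K).DefinableFun L (fun v => f v * g v) :=
  definableFun_ringSymbol (t := ![f, g]) Ring.mulFunc (by simp [Fin.forall_fin_two, hf, hg])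

theorem _root_.Set.DefinableFun.neg (hf : (univ : Set K).DefinableFun L f) :
    (univ : Set K).DefinableFun L (fun v => -f v) :=
  definableFun_ringSymbol (t := ![f]) Ring.negFunc (by simp [hf])

theorem _root_.Set.DefinableFun.sub (hf : (univ : Set K).DefinableFun L f)
    (hg : (univ : Set K).DefinableFun L g) :
    (univ : Set K).DefinableFun L (fun v => f v - g v) := by
  simp_rw [sub_eq_add_neg]
  exact hf.add hg.neg

theorem definablePred_mem_unitBall (hf : (univ : Set K).DefinableFun L f) :
    DefinablePred L (univ : Set K) (fun v => f v ∈ unitBall (K := K)) := by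
  obtain ⟨ι, hι⟩ := IsExpansion.exists_hom (L := L) (K := K)
  let := ringPredStructure K (unitBall (K := K))
  have h : DefinablePred L (univ : Set K) (fun v : Fin 1 → K => v 0 ∈ unitBall (K := K)) := by
    refine Set.Definable.mono (Set.empty_definable_iff.2
      ⟨(ι.onRelation PredRel.pred).formula (fun i => Language.Term.var i), ?_⟩) (subset_univ _)
    ext v
    simp only [mem_ofPred_eq]
    rw [Language.Formula.realize_rel]
    exact (iff_of_eq (hι.map_onRelation (n := 1) PredRel.pred v)).symm
  exact h.subst (t := fun _ => f) (fun _ => hf)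

theorem definablePred_absLE (hf : (univ : Set K).DefinableFun L f)
    (hg : (univ : Set K).DefinableFun L g) :
    DefinablePred L (univ : Set K) (fun v => AbsLE (unitBall (K := K)) (f v) (g v)) := by
  refine DefinablePred.exists (DefinablePred.and (definablePred_mem_unitBall (DefinableFun.proj L)) ?_)
  exact DefinablePred.eq (hf.relabel _) ((hg.relabel _).mul (DefinableFun.proj L))

theorem definablePred_absLT (hf : (univ : Set K).DefinableFun L f)
    (hg : (univ : Set K).DefinableFun L g) :
    DefinablePred L (univ : Set K) (fun v => AbsLT (unitBall (K := K)) (f v) (g v)) :=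
  (definablePred_absLE hg hf).not

theorem _root_.Set.DefinableFun.inv (hf : (univ : Set K).DefinableFun L f) :
    (univ : Set K).DefinableFun L (fun v => (f v)⁻¹) := by
  refine definableFun_of_pred ?_
  have h1 := hf.relabel (α := Option α) some
  -- The graph needs a separate clause at zero because of the convention `0⁻¹ = 0`.
  refine (((DefinablePred.eq h1 (definableFun_const 0)).and
    (DefinablePred.eq (DefinableFun.proj L (i := none)) (definableFun_const 0))).or
    (DefinablePred.eq (h1.mul (DefinableFun.proj L (i := none))) (definableFun_const 1))).congr fun w => ?_
  by_cases h : f (fun a => w (some a)) = 0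
  · simp [h, eq_comm]
  · simp only [h, false_and, false_or]
    exact ⟨fun e => by rw [← e, mul_inv_cancel₀ h], fun e => inv_eq_of_mul_eq_one_right e⟩

end FieldDefinable

/-! ### The topology of the field -/

section FieldTopology

variable {K : Type u} [Field K] [TopologicalSpace K] [OrderedOrValuedField K]

theorem zero_mem_unitBall : (0 : K) ∈ unitBall (K := K) := by
  rcases OrderedOrValuedField.unitBall_spec (K := K) with ⟨_, _, h⟩ | ⟨V, -, h⟩
  · simp [h]
  · simp [h]

theorem one_mem_unitBall : (1 : K) ∈ unitBall (K := K) := by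
  rcases OrderedOrValuedField.unitBall_spec (K := K) with ⟨_, _, h⟩ | ⟨V, -, h⟩
  · simp only [h, mem_Icc, le_refl, and_true]
    linarith [zero_le_one (α := K)]
  · simp [h]

theorem mul_mem_unitBall {a b : K} (ha : a ∈ unitBall (K := K)) (hb : b ∈ unitBall (K := K)) :
    a * b ∈ unitBall (K := K) := by
  rcases OrderedOrValuedField.unitBall_spec (K := K) with ⟨_, _, h⟩ | ⟨V, -, h⟩
  · rw [h, mem_Icc, ← abs_le] at ha hb ⊢
    rw [abs_mul]
    exact mul_le_one₀ ha (abs_nonneg _) hb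
  · rw [h] at ha hb ⊢
    exact V.mul_mem _ _ ha hb

theorem inv_mem_unitBall {a : K} (ha : a ∉ unitBall (K := K)) : a⁻¹ ∈ unitBall (K := K) := by
  rcases OrderedOrValuedField.unitBall_spec (K := K) with ⟨_, _, h⟩ | ⟨V, -, h⟩
  · rw [h, mem_Icc, ← abs_le] at ha ⊢
    rw [abs_inv]
    exact inv_le_one_of_one_le₀ (not_le.1 ha).le
  · rw [h] at ha ⊢
    exact (V.mem_or_inv_mem a).resolve_left ha

theorem exists_notMem_unitBall : ∃ a : K, a ∉ unitBall (K := K) := by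
  rcases OrderedOrValuedField.unitBall_spec (K := K) with ⟨_, _, h⟩ | ⟨V, hV, h⟩
  · refine ⟨2, ?_⟩
    rw [h, mem_Icc, not_and, not_le]
    exact fun _ => one_lt_two
  · by_contra! H
    exact hV (top_unique fun x _ => by simpa [h] using H x)

theorem absLE_of_not_absLE {x y : K} (h : ¬ AbsLE (unitBall (K := K)) x y) :
    AbsLE (unitBall (K := K)) y x := by
  by_cases hy : y = 0
  · exact ⟨0, zero_mem_unitBall, by simp [hy]⟩
  by_cases hx : x = 0
  · exact absurd ⟨0, zero_mem_unitBall, by simp [hx]⟩ h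
  refine ⟨y / x, ?_, by field_simp⟩
  rw [← inv_div]
  exact inv_mem_unitBall fun H => h ⟨_, H, by field_simp⟩

theorem absLE_iff_div {x y : K} (hy : y ≠ 0) :
    AbsLE (unitBall (K := K)) x y ↔ x / y ∈ unitBall (K := K) := by
  constructor
  · rintro ⟨a, ha, rfl⟩
    rwa [mul_div_cancel_left₀ _ hy]
  · exact fun h => ⟨_, h, by field_simp⟩

theorem unitBall_mem_nhds : unitBall (K := K) ∈ 𝓝 (0 : K) := by
  refine (OrderedOrValuedField.nhds_hasBasis (0 : K)).mem_iff.2 ⟨1, one_ne_zero, fun x hx => ?_⟩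
  rw [mem_ofPred_eq, sub_zero] at hx
  obtain ⟨a, ha, rfl⟩ := absLE_of_not_absLE hx
  simpa using ha

/-- Passes from strict balls to multiples of the unit ball, which behave well under products.
Dividing the radius by some `t` with `|t| > 1` turns the non-strict inequality into a strict one. -/
theorem exists_mul_unitBall_subset {N : Set K} (hN : N ∈ 𝓝 (0 : K)) :
    ∃ ε : K, ε ≠ 0 ∧ ∀ a ∈ unitBall (K := K), ε * a ∈ N := by
  obtain ⟨r, hr, hrN⟩ := (OrderedOrValuedField.nhds_hasBasis (0 : K)).mem_iff.1 hN
  obtain ⟨t, ht⟩ := exists_notMem_unitBall (K := K)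
  have ht0 : t ≠ 0 := fun h => ht (h ▸ zero_mem_unitBall)
  refine ⟨r / t, div_ne_zero hr ht0, fun a ha => hrN ?_⟩
  rintro ⟨b, hb, e⟩
  refine ht ?_
  have : t = a * b := by
    apply mul_left_cancel₀ hr
    have : r * t = r / t * a * b * t := by rw [← sub_zero (r / t * a), ← e]
    rw [this]
    field_simp
  exact this ▸ mul_mem_unitBall ha hb

/-- A squeeze principle that serves ordered and valued fields alike: once `y ∈ ε * O`, also `z ∈ ε *
O`, because `O` is closed under products. -/
theorem tendsto_zero_of_absLE {ι : Type*} {l : Filter ι} {y z : ι → K} (hy : Tendsto y l (𝓝 0))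
    (h : ∀ᶠ i in l, AbsLE (unitBall (K := K)) (z i) (y i)) : Tendsto z l (𝓝 0) := by
  intro N hN
  obtain ⟨ε, hε, hεN⟩ := exists_mul_unitBall_subset hN
  have h1 : Tendsto (fun i => ε⁻¹ * y i) l (𝓝 0) := by
    simpa using hy.const_mul ε⁻¹
  change ∀ᶠ i in l, z i ∈ N
  filter_upwards [h, h1 unitBall_mem_nhds] with i ⟨a, ha, hza⟩ hi
  have := hεN _ (mul_mem_unitBall hi ha)
  rwa [← mul_assoc, mul_inv_cancel_left₀ hε, ← hza] at this

instance t1Space : T1Space K := by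
  refine t1Space_iff_exists_open.2 fun x y hxy => ?_
  obtain ⟨U, hU, hUo, hx⟩ := mem_nhds_iff.1
    ((OrderedOrValuedField.nhds_hasBasis x).mem_of_mem (sub_ne_zero.2 hxy.symm))
  exact ⟨U, hUo, hx, fun hy => hU hy ⟨1, one_mem_unitBall, by simp⟩⟩

instance isTopologicalDivisionRing : IsTopologicalDivisionRing K where
  continuousAt_inv₀ := by
    intro a ha
    have hd : ∃ N ∈ 𝓝 (0 : K), ∀ᶠ x in 𝓝 a, x ∉ N := by
      obtain ⟨U, V, hU, hV, h0, h1, hd⟩ := t2_separation (ha.symm)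
      exact ⟨U, hU.mem_nhds h0, Eventually.mono (hV.mem_nhds h1) fun x hx hxU => disjoint_left.1 hd hxU hx⟩
    obtain ⟨N, hN, hNa⟩ := hd
    obtain ⟨ε, hε, hεN⟩ := exists_mul_unitBall_subset hN
    have h1 : Tendsto (fun x : K => (a - x) * (ε⁻¹ * a⁻¹)) (𝓝 a) (𝓝 0) := by
      have : Continuous (fun x : K => (a - x) * (ε⁻¹ * a⁻¹)) := by fun_prop
      simpa using this.tendsto a
    have h2 : Tendsto (fun x : K => x⁻¹ - a⁻¹) (𝓝 a) (𝓝 0) := by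
      -- `x⁻¹ - a⁻¹ = (a - x) * x⁻¹ * a⁻¹`, and `|x⁻¹| ≤ |ε⁻¹|` because `x` stays outside `ε * O`
      -- near `a`.
      refine tendsto_zero_of_absLE h1 ?_
      filter_upwards [hNa, isOpen_ne.mem_nhds ha] with x hx hx0
      have hx0 : x ≠ 0 := hx0
      refine ⟨(ε⁻¹ * x)⁻¹, inv_mem_unitBall fun H => hx ?_, by field_simp⟩
      simpa [hε] using hεN _ H
    simpa [ContinuousAt] using h2.add_const a⁻¹

/-- The dichotomy behind the explicit constructions: polynomial formulas in the ordered case, cases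
on a clopen set in the valued case. A valuation ring is clopen because it is an open additive
subgroup. -/
theorem orderTopology_or_isClopen :
    (∃ (_ : LinearOrder K) (_ : IsStrictOrderedRing K), OrderTopology K ∧
      unitBall (K := K) = Icc (-1) 1) ∨ IsClopen (unitBall (K := K)) := by
  rcases OrderedOrValuedField.unitBall_spec (K := K) with ⟨lo, so, h⟩ | ⟨V, -, h⟩
  · refine Or.inl ⟨lo, so, ⟨TopologicalSpace.ext_nhds fun c => ?_⟩, h⟩
    have hlt : ∀ x r : K, r ≠ 0 → (AbsLT (unitBall (K := K)) x r ↔ |x| < |r|) := by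
      intro x r hr
      by_cases hx : x = 0
      · subst hx
        refine iff_of_true ?_ (by simpa using hr)
        rintro ⟨a, -, e⟩
        simp at e
        exact hr e
      · rw [AbsLT, absLE_iff_div hx, h, mem_Icc, ← abs_le, abs_div, div_le_one (by positivity),
          not_le]
    have hb : (𝓝 c).HasBasis (fun r : K => 0 < r) (fun r => {x | |x - c| < r}) := by
      refine (OrderedOrValuedField.nhds_hasBasis c).to_hasBasis ?_ ?_
      · exact fun r hr => ⟨|r|, abs_pos.2 hr, fun x hx => (hlt _ _ hr).2 hx⟩
      · exact fun r hr => ⟨r, hr.ne', fun x hx => by simpa [abs_of_pos hr] using (hlt _ _ hr.ne').1 hx⟩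
    let := Preorder.topology K
    have : OrderTopology K := ⟨rfl⟩
    exact hb.eq_of_same_basis (nhds_basis_abs_sub_lt c)
  · right
    have hV : (V.toSubring.toAddSubgroup : Set K) = unitBall (K := K) := h.symm
    have ho := AddSubgroup.isOpen_of_mem_nhds V.toSubring.toAddSubgroup (g := 0)
      (hV ▸ unitBall_mem_nhds)
    rw [← hV]
    exact ⟨AddSubgroup.isClosed_of_isOpen _ ho, ho⟩

end FieldTopology

/-! ### Auxiliary continuous definable functions on affine space -/

section Auxiliary

variable (L : FirstOrder.Language.{v, w}) {K : Type u} [Field K] [TopologicalSpace K]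
  [OrderedOrValuedField K] [L.Structure K] [IsExpansion L K] {α : Type}

theorem _root_.Set.DefinableFun.finset_prod {L : FirstOrder.Language.{v, w}} [L.Structure K]
    [IsExpansion L K] {ι : Type*} (s : Finset ι) {f : ι → (α → K) → K}
    (hf : ∀ i, (univ : Set K).DefinableFun L (f i)) :
    (univ : Set K).DefinableFun L (fun v => ∏ i ∈ s, f i v) := by
  classical
  induction s using Finset.induction_on with
  | empty => simpa using definableFun_const (L := L) (α := α) (1 : K)
  | insert a s ha ih =>
    simp_rw [Finset.prod_insert ha]
    exact (hf a).mul ih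

theorem _root_.Set.DefinableFun.finset_sum {L : FirstOrder.Language.{v, w}} [L.Structure K]
    [IsExpansion L K] {ι : Type*} (s : Finset ι) {f : ι → (α → K) → K}
    (hf : ∀ i, (univ : Set K).DefinableFun L (f i)) :
    (univ : Set K).DefinableFun L (fun v => ∑ i ∈ s, f i v) := by
  classical
  induction s using Finset.induction_on with
  | empty => simpa using definableFun_const (L := L) (α := α) (0 : K)
  | insert a s ha ih =>
    simp_rw [Finset.sum_insert ha]
    exact (hf a).add ih

open scoped Classical in
/-- A function supported on the unit ball. -/
theorem exists_bump_unitBall : ∃ b : K → K, Continuous b ∧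
    (univ : Set K).DefinableFun L (fun v : Unit → K => b (v ())) ∧ b 0 = 1 ∧
    (∀ x, x ∉ unitBall (K := K) → b x = 0) ∧ ∀ x, b x ∈ unitBall (K := K) := by
  have hp : (univ : Set K).DefinableFun L (fun v : Unit → K => v ()) := DefinableFun.proj L
  rcases orderTopology_or_isClopen (K := K) with ⟨lo, so, ot, h⟩ | h
  · refine ⟨fun x => if x ∈ unitBall (K := K) then 1 - x * x else 0, ?_, ?_, ?_, ?_, ?_⟩
    · have : (fun x : K => if x ∈ unitBall (K := K) then 1 - x * x else 0) =
          fun x => if |x| ≤ 1 then 1 - x * x else 0 := by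
        simp only [h, mem_Icc, ← abs_le]
      rw [this]
      refine Continuous.if_le (by fun_prop) continuous_const continuous_abs continuous_const ?_
      intro x hx
      rw [← abs_mul_abs_self, hx]
      simp
    · exact DefinableFun.ite (definablePred_mem_unitBall hp)
        ((definableFun_const 1).sub (hp.mul hp)) (definableFun_const 0)
    · simp [zero_mem_unitBall]
    · intro x hx
      simp [hx]
    · intro x
      dsimp only
      split_ifs with hx
      · rw [h, mem_Icc, ← abs_le] at hx
        have h2 : x * x ≤ 1 := by
          rw [← abs_mul_abs_self]
          exact mul_le_one₀ hx (abs_nonneg _) hx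
        rw [h]
        constructor <;> linarith [mul_self_nonneg x]
      · exact zero_mem_unitBall
  · refine ⟨fun x => if x ∈ unitBall (K := K) then 1 else 0, ?_, ?_, ?_, ?_, ?_⟩
    · refine Continuous.if ?_ continuous_const continuous_const
      intro a ha
      have : frontier (unitBall (K := K)) = ∅ := h.frontier_eq
      rw [ofPred_mem_eq, this] at ha
      exact ha.elim
    · exact DefinableFun.ite (definablePred_mem_unitBall hp)
        (definableFun_const 1) (definableFun_const 0)
    · simp [zero_mem_unitBall]
    · intro x hx
      simp [hx]
    · intro x
      dsimp only
      split_ifs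
      · exact one_mem_unitBall
      · exact zero_mem_unitBall

theorem exists_bump {m : ℕ} {c : Fin m → K} {W : Set (Fin m → K)} (hW : W ∈ 𝓝 c) :
    ∃ χ : (Fin m → K) → K, Continuous χ ∧ (univ : Set K).DefinableFun L χ ∧ χ c = 1 ∧
      (∀ x, x ∉ W → χ x = 0) ∧ ∀ x, χ x ∈ unitBall (K := K) := by
  rw [nhds_pi, Filter.mem_pi] at hW
  obtain ⟨I, -, t, ht, htW⟩ := hW
  have hε : ∀ i, ∃ ε : K, ε ≠ 0 ∧ ∀ a ∈ unitBall (K := K), ε * a + c i ∈ t i := by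
    intro i
    have h0 : Tendsto (fun x : K => x + c i) (𝓝 0) (𝓝 (c i)) := by
      have : Continuous (fun x : K => x + c i) := by fun_prop
      simpa using this.tendsto 0
    exact exists_mul_unitBall_subset (h0 (ht i))
  choose ε hε hεt using hε
  obtain ⟨b, hbc, hbd, hb0, hb1, hbO⟩ := exists_bump_unitBall L (K := K)
  refine ⟨fun x => ∏ i, b ((ε i)⁻¹ * (x i - c i)), ?_, ?_, ?_, ?_, ?_⟩
  · fun_prop
  · refine DefinableFun.finset_prod _ fun i => ?_
    exact hbd.subst (t := fun _ v => (ε i)⁻¹ * (v i - c i)) fun _ =>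
      (definableFun_const _).mul ((DefinableFun.proj L).sub (definableFun_const _))
  · simp [hb0]
  · intro x hx
    obtain ⟨i, -, hi⟩ : ∃ i ∈ I, x i ∉ t i := by
      by_contra! H
      exact hx (htW H)
    refine Finset.prod_eq_zero (Finset.mem_univ i) (hb1 _ fun H => hi ?_)
    simpa [mul_inv_cancel_left₀ (hε i)] using hεt i _ H
  · intro x
    refine Finset.prod_induction _ (· ∈ unitBall (K := K)) (fun _ _ => mul_mem_unitBall)
      one_mem_unitBall fun i _ => hbO _

-- Where `w.1 ≠ 0` the condition says `w.2 / w.1 ∈ O`, which is locally constant since `O` is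
-- clopen. Where `w.1 = 0` the function vanishes, and it tends to `0` because it is bounded by
-- `|w.1|`.
open scoped Classical in
theorem continuous_ite_absLE (hO : IsClopen (unitBall (K := K))) {g : K × K → K}
    (hg : Continuous g) (hgle : ∀ w : K × K, AbsLE (unitBall (K := K)) w.2 w.1 →
      AbsLE (unitBall (K := K)) (g w) w.1) :
    Continuous fun w : K × K => if AbsLE (unitBall (K := K)) w.2 w.1 then g w else 0 := by
  have hle : ∀ w : K × K, AbsLE (unitBall (K := K))
      (if AbsLE (unitBall (K := K)) w.2 w.1 then g w else 0) w.1 := by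
    intro w
    split_ifs with h
    · exact hgle w h
    · exact ⟨0, zero_mem_unitBall, by simp⟩
  refine continuous_iff_continuousAt.2 fun ⟨a, b⟩ => ?_
  by_cases ha : a = 0
  · subst ha
    have h0 := hle (0, b)
    obtain ⟨c, -, hc⟩ := h0
    rw [zero_mul] at hc
    rw [ContinuousAt, hc]
    exact tendsto_zero_of_absLE continuous_fst.continuousAt (Eventually.of_forall hle)
  · have hdiv : ContinuousAt (fun w : K × K => w.2 / w.1) (a, b) :=
      continuousAt_snd.div₀ continuousAt_fst ha
    have hne : ∀ᶠ w : K × K in 𝓝 (a, b), w.1 ≠ 0 :=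
      continuousAt_fst.eventually_ne ha
    by_cases hb : b / a ∈ unitBall (K := K)
    · refine hg.continuousAt.congr ?_
      filter_upwards [hne, hdiv (hO.isOpen.mem_nhds hb)] with w hw hw'
      rw [if_pos ((absLE_iff_div hw).2 hw')]
    · refine (continuousAt_const (y := (0 : K))).congr ?_
      filter_upwards [hne, hdiv (hO.compl.isOpen.mem_nhds hb)] with w hw hw'
      rw [if_neg (mt (absLE_iff_div hw).1 hw')]

-- The combination is `w.1² + w.2²` in the ordered case. In the valued case a sum of squares may
-- vanish, so it is the square of whichever coordinate is larger, with `w.1` chosen in case of a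
-- tie.
open scoped Classical in
theorem exists_combination_ne_zero : ∃ f g : K × K → K, Continuous f ∧ Continuous g ∧
    (univ : Set K).DefinableFun L (fun v : Fin 2 → K => f (v 0, v 1)) ∧
    (univ : Set K).DefinableFun L (fun v : Fin 2 → K => g (v 0, v 1)) ∧
    ∀ w : K × K, f w * w.1 + g w * w.2 = 0 → w = 0 := by
  have hp : ∀ i, (univ : Set K).DefinableFun L (fun v : Fin 2 → K => v i) :=
    fun i => DefinableFun.proj L
  rcases orderTopology_or_isClopen (K := K) with ⟨lo, so, ot, h⟩ | h
  · refine ⟨Prod.fst, Prod.snd, continuous_fst, continuous_snd, hp 0, hp 1, fun w hw => ?_⟩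
    exact Prod.ext ((mul_self_add_mul_self_eq_zero.1 hw).1) ((mul_self_add_mul_self_eq_zero.1 hw).2)
  · have hc1 := continuous_ite_absLE h (g := Prod.fst) continuous_fst
      fun w _ => ⟨1, one_mem_unitBall, by simp⟩
    have hc2 := continuous_ite_absLE h (g := Prod.snd) continuous_snd fun w hw => hw
    -- The second coefficient is `w.2` where `|w.2| > |w.1|` and `0` elsewhere. Writing it as a
    -- difference leaves a truncation bounded by `|w.1|`, whose continuity is known.
    refine ⟨_, fun w => w.2 - _, hc1, continuous_snd.sub hc2, ?_, ?_, fun w hw => ?_⟩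
    · exact DefinableFun.ite (definablePred_absLE (hp 1) (hp 0)) (hp 0) (definableFun_const 0)
    · exact (hp 1).sub
        (DefinableFun.ite (definablePred_absLE (hp 1) (hp 0)) (hp 1) (definableFun_const 0))
    · by_cases hle : AbsLE (unitBall (K := K)) w.2 w.1
      · simp only [hle, if_true, sub_self, zero_mul, add_zero, mul_self_eq_zero] at hw
        obtain ⟨c, -, hc⟩ := hle
        rw [hw, zero_mul] at hc
        exact Prod.ext hw hc
      · simp only [hle, if_false, sub_zero, zero_mul, zero_add, mul_self_eq_zero] at hw
        exact absurd ⟨0, zero_mem_unitBall, by simp [hw]⟩ hle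

end Auxiliary

/-! ### Constructing continuous definable functions -/

section Construction

theorem isDefinableFun_of_definableFun {L : FirstOrder.Language.{v, w}} {K : Type u}
    [L.Structure K] {m : ℕ} {X : Set (Fin m → K)} (hX : (univ : Set K).Definable L X)
    {G : (Fin m → K) → K} (hG : (univ : Set K).DefinableFun L G) :
    IsDefinableFun L (fun x : X => G x) := by
  have h1 : DefinablePred L (univ : Set K)
      (fun z : Fin (m + 1) → K => (fun i : Fin m => z i.castSucc) ∈ X) :=
    hX.preimage_comp (β := Fin (m + 1)) Fin.castSucc
  refine (h1.and (DefinablePred.eq (DefinableFun.proj L (i := Fin.last m))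
    (hG.relabel (α := Fin (m + 1)) Fin.castSucc))).congr fun z => ?_
  constructor
  · rintro ⟨x, rfl⟩
    simp
  · rintro ⟨hx, hz⟩
    refine ⟨⟨_, hx⟩, ?_⟩
    ext i
    refine Fin.lastCases ?_ (fun i => ?_) i
    · simpa using hz
    · simp

variable {L : FirstOrder.Language.{v, w}} {K : Type u} [Field K] [L.Structure K] {m : ℕ}
  {X : Set (Fin m → K)}

open scoped Classical in
/-- Extension of a function by zero. -/
def extendZero (f : X → K) (x : Fin m → K) : K := if h : x ∈ X then f ⟨x, h⟩ else 0

theorem extendZero_coe (f : X → K) (x : X) : extendZero f x = f x := by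
  simp [extendZero]

theorem extendZero_of_notMem (f : X → K) {x : Fin m → K} (hx : x ∉ X) : extendZero f x = 0 := by
  simp [extendZero, hx]

theorem IsDefinableFun.definableFun_extendZero (hX : (univ : Set K).Definable L X) {f : X → K}
    (hf : IsDefinableFun L f) : (univ : Set K).DefinableFun L (extendZero f) := by
  refine definableFun_of_pred ?_
  have h1 : DefinablePred L (univ : Set K) (fun w : Option (Fin m) → K => _) :=
    hf.preimage_comp (β := Option (Fin m)) (Fin.snoc (α := fun _ => Option (Fin m)) some none)
  have h2 : DefinablePred L (univ : Set K)
      (fun w : Option (Fin m) → K => (fun i => w (some i)) ∈ X) :=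
    hX.preimage_comp (β := Option (Fin m)) some
  refine (h1.or (h2.not.and
    (DefinablePred.eq (DefinableFun.proj L (i := none)) (definableFun_const 0)))).congr fun w => ?_
  have key : ∀ x : X, (w ∘ (Fin.snoc (α := fun _ => Option (Fin m)) some none : Fin (m + 1) → _) =
      Fin.snoc (α := fun _ => K) (x : Fin m → K) (f x)) ↔
      (fun i => w (some i)) = (x : Fin m → K) ∧ w none = f x := by
    intro x
    constructor
    · intro h
      refine ⟨funext fun i => ?_, ?_⟩
      · simpa using congrFun h i.castSucc
      · simpa using congrFun h (Fin.last m)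
    · rintro ⟨h, h'⟩
      ext i
      refine Fin.lastCases ?_ (fun i => ?_) i
      · simpa using h'
      · simpa using congrFun h i
  change _ ↔ (∃ x : X, _) ∨ _
  simp_rw [key]
  by_cases hw : (fun i => w (some i)) ∈ X
  · simp only [hw, not_true, false_and, or_false]
    constructor
    · intro h
      exact ⟨⟨_, hw⟩, rfl, h.symm.trans (extendZero_coe f ⟨_, hw⟩)⟩
    · rintro ⟨x, hx, hn⟩
      rw [hn, hx, extendZero_coe]
  · simp only [hw, not_false_iff, true_and, extendZero_of_notMem f hw]
    constructor
    · exact fun h => Or.inr h.symm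
    · rintro (⟨x, hx, -⟩ | h)
      · exact absurd (hx ▸ x.2) hw
      · exact h.symm

end Construction

/-! ### The ring of continuous definable functions and its weak Nullstellensatz. -/

section Ring

variable {L : FirstOrder.Language.{v, w}} {K : Type u} [Field K] [TopologicalSpace K]
  [OrderedOrValuedField K] [L.Structure K] [IsExpansion L K] {m : ℕ}
  {X : Set (Fin m → K)} {hX : (univ : Set K).Definable L X}

instance : CoeFun (contDefRing L hX) (fun _ => X → K) := ⟨fun f => f.1⟩

variable (hX) in
theorem exists_contDef_of_definableFun {G : (Fin m → K) → K}
    (hG : (univ : Set K).DefinableFun L G) (hc : Continuous fun x : X => G x) :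
    ∃ f : contDefRing L hX, ∀ x : X, f x = G x :=
  ⟨⟨fun x => G x, hc, isDefinableFun_of_definableFun hX hG⟩, fun _ => rfl⟩

theorem continuous_contDef (f : contDefRing L hX) : Continuous (f : X → K) := f.2.1

theorem definableFun_contDef (f : contDefRing L hX) :
    (univ : Set K).DefinableFun L (extendZero (f : X → K)) :=
  f.2.2.definableFun_extendZero hX

variable (hX) in
theorem exists_const (c : K) : ∃ f : contDefRing L hX, ∀ x : X, f x = c :=
  exists_contDef_of_definableFun hX (definableFun_const c) continuous_const

@[simp] theorem contDef_add (f g : contDefRing L hX) (x : X) : (f + g) x = f x + g x := rfl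
@[simp] theorem contDef_mul (f g : contDefRing L hX) (x : X) : (f * g) x = f x * g x := rfl
@[simp] theorem contDef_sub (f g : contDefRing L hX) (x : X) : (f - g) x = f x - g x := rfl
@[simp] theorem contDef_one (x : X) : (1 : contDefRing L hX) x = 1 := rfl
@[simp] theorem contDef_zero (x : X) : (0 : contDefRing L hX) x = 0 := rfl

theorem contDef_ext {f g : contDefRing L hX} (h : ∀ x : X, f x = g x) : f = g :=
  Subtype.ext (funext h)

theorem exists_comp_pair {F : K × K → K} (hF : Continuous F)
    (hFd : (univ : Set K).DefinableFun L (fun v : Fin 2 → K => F (v 0, v 1)))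
    (f g : contDefRing L hX) : ∃ h : contDefRing L hX, ∀ x : X, h x = F (f x, g x) := by
  obtain ⟨h, hh⟩ := exists_contDef_of_definableFun hX
    (G := fun x => F (extendZero (f : X → K) x, extendZero (g : X → K) x))
    (hFd.subst (t := ![extendZero (f : X → K), extendZero (g : X → K)])
      (by simp [Fin.forall_fin_two, definableFun_contDef]))
    (by
      simp_rw [extendZero_coe]
      exact hF.comp ((continuous_contDef f).prodMk (continuous_contDef g)))
  exact ⟨h, fun x => by rw [hh, extendZero_coe, extendZero_coe]⟩

theorem exists_inv (f : contDefRing L hX) (hf : ∀ x : X, f x ≠ 0) :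
    ∃ g : contDefRing L hX, ∀ x : X, g x = (f x)⁻¹ := by
  obtain ⟨h, hh⟩ := exists_contDef_of_definableFun hX (definableFun_contDef f).inv
    (by
      simp_rw [extendZero_coe]
      exact (continuous_contDef f).inv₀ hf)
  exact ⟨h, fun x => by rw [hh, extendZero_coe]⟩

/-- Replaces two functions by one element of the ideal they generate whose zeros are all common
zeros. If there are none, this element is invertible, which gives the Nullstellensatz. -/
theorem exists_combination (f g : contDefRing L hX) : ∃ a b : contDefRing L hX,
    ∀ x : X, (a * f + b * g) x = 0 → f x = 0 ∧ g x = 0 := by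
  obtain ⟨F, G, hF, hG, hFd, hGd, h⟩ := exists_combination_ne_zero L (K := K)
  obtain ⟨a, ha⟩ := exists_comp_pair hF hFd f g
  obtain ⟨b, hb⟩ := exists_comp_pair hG hGd f g
  refine ⟨a, b, fun x hx => ?_⟩
  have := h (f x, g x) (by simpa [ha, hb] using hx)
  simpa using this

/-- The weak Nullstellensatz for two functions. -/
theorem exists_eq_one_iff (f g : contDefRing L hX) :
    (∃ a b : contDefRing L hX, a * f + b * g = 1) ↔ ∀ x : X, ¬ (f x = 0 ∧ g x = 0) := by
  constructor
  · rintro ⟨a, b, h⟩ x ⟨hf, hg⟩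
    have : (a * f + b * g) x = 1 := by rw [h]; rfl
    simp [hf, hg] at this
  · intro h
    obtain ⟨a, b, hab⟩ := exists_combination f g
    obtain ⟨c, hc⟩ := exists_inv (a * f + b * g) fun x hx => h x (hab x hx)
    refine ⟨c * a, c * b, contDef_ext fun x => ?_⟩
    have : (a * f + b * g) x ≠ 0 := fun hx => h x (hab x hx)
    have e : c * a * f + c * b * g = c * (a * f + b * g) := by ring
    rw [e, contDef_mul, hc, inv_mul_cancel₀ this]
    rfl

/-- The weak Nullstellensatz for three functions. -/
theorem exists_eq_one_iff₃ (f g h : contDefRing L hX) :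
    (∃ a b c : contDefRing L hX, a * f + b * g + c * h = 1) ↔
      ∀ x : X, ¬ (f x = 0 ∧ g x = 0 ∧ h x = 0) := by
  constructor
  · rintro ⟨a, b, c, e⟩ x ⟨hf, hg, hh⟩
    have : (a * f + b * g + c * h) x = 1 := by rw [e]; rfl
    simp [hf, hg, hh] at this
  · intro H
    obtain ⟨a, b, hab⟩ := exists_combination f g
    obtain ⟨c, d, e⟩ := (exists_eq_one_iff (a * f + b * g) h).2
      fun x hx => H x ⟨(hab x hx.1).1, (hab x hx.1).2, hx.2⟩
    exact ⟨c * a, c * b, d, by rw [← e]; ring⟩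

end Ring

/-! ### Cluster sets -/

section Cluster

variable {L : FirstOrder.Language.{v, w}} {K : Type u} [Field K] [TopologicalSpace K]
  [OrderedOrValuedField K] [L.Structure K] [IsExpansion L K] {m : ℕ}
  {X : Set (Fin m → K)} {hX : (univ : Set K).Definable L X}

/-- The set of cluster values at `p₀` of `f / p` along the zero set of `s`. -/
def clusterSet (p₀ : X) (p f s : contDefRing L hX) : Set K :=
  {c | MapClusterPt c (𝓝[≠] p₀ ⊓ 𝓟 {x | s x = 0}) (fun x => f x / p x)}

variable {p₀ : X} {p : contDefRing L hX}

theorem isClosed_clusterSet (f s : contDefRing L hX) : IsClosed (clusterSet p₀ p f s) :=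
  isClosed_setOfPred_clusterPt

theorem mem_clusterSet_iff_frequently {f s : contDefRing L hX} {c : K} :
    c ∈ clusterSet p₀ p f s ↔
      ∀ N ∈ 𝓝 c, ∃ᶠ x in 𝓝 p₀, x ≠ p₀ ∧ s x = 0 ∧ f x / p x ∈ N := by
  rw [clusterSet, mem_ofPred_eq, mapClusterPt_iff_frequently]
  refine forall₂_congr fun N _ => ?_
  rw [frequently_inf_principal, frequently_nhdsWithin_iff]
  refine frequently_congr (Eventually.of_forall fun x => ?_)
  simp only [mem_ofPred_eq, mem_compl_iff, mem_singleton_iff]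
  tauto

theorem nhds_hasBasis_absLT (a : Fin m → K) : (𝓝 a).HasBasis (fun r : Fin m → K => ∀ i, r i ≠ 0)
    (fun r => {x | ∀ i, AbsLT (unitBall (K := K)) (x i - a i) (r i)}) := by
  rw [nhds_pi]
  refine (hasBasis_pi fun i => OrderedOrValuedField.nhds_hasBasis (a i)).to_hasBasis ?_ ?_
  · classical
    rintro ⟨I, r⟩ ⟨-, hr⟩
    refine ⟨fun i => if i ∈ I then r i else 1, fun i => ?_, fun x hx i hi => ?_⟩
    · dsimp only
      split_ifs with hi
      · exact hr i hi
      · exact one_ne_zero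
    · simpa [show i ∈ I from hi] using hx i
  · exact fun r hr => ⟨(univ, r), ⟨finite_univ, fun i _ => hr i⟩, fun x hx i => hx i (mem_univ i)⟩

/-- Needed in order to apply (BFin). Unfolding the cluster condition over basic balls gives a
formula over `K`, with `x ≠ p₀` expressed as `p x ≠ 0`. -/
theorem definable_clusterSet (hp : ∀ x : X, p x = 0 ↔ x = p₀) (f s : contDefRing L hX) :
    (univ : Set K).Definable₁ L (clusterSet p₀ p f s) := by
  have key : ∀ c : K, c ∈ clusterSet p₀ p f s ↔ ∀ ε : K, ε ≠ 0 → ∀ r : Fin m → K,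
      (∀ i, r i ≠ 0) → ∃ y : Fin m → K, (∀ i, AbsLT (unitBall (K := K)) (y i - (p₀ : Fin m → K) i) (r i)) ∧
        y ∈ X ∧ extendZero (p : X → K) y ≠ 0 ∧ extendZero (s : X → K) y = 0 ∧
        AbsLT (unitBall (K := K))
          (extendZero (f : X → K) y * (extendZero (p : X → K) y)⁻¹ - c) ε := by
    intro c
    rw [clusterSet, mem_ofPred_eq,
      (OrderedOrValuedField.nhds_hasBasis c).mapClusterPt_iff_frequently]
    refine forall₂_congr fun ε _ => ?_
    rw [frequently_inf_principal, frequently_nhdsWithin_iff, nhds_subtype,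
      ((nhds_hasBasis_absLT (p₀ : Fin m → K)).comap _).frequently_iff]
    refine forall₂_congr fun r _ => ?_
    constructor
    · rintro ⟨x, hx, ⟨hs, hf⟩, hx0⟩
      refine ⟨x, hx, x.2, ?_, ?_, ?_⟩
      · rw [extendZero_coe]
        exact mt (hp x).1 hx0
      · rw [extendZero_coe]
        exact hs
      · rw [extendZero_coe, extendZero_coe, ← div_eq_mul_inv]
        exact hf
    · rintro ⟨y, hy, hyX, hp0, hs, hf⟩
      have e : ∀ g : X → K, extendZero g y = g ⟨y, hyX⟩ := fun g => extendZero_coe g ⟨y, hyX⟩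
      rw [e] at hp0 hs
      rw [e, e, ← div_eq_mul_inv] at hf
      exact ⟨⟨y, hyX⟩, hy, ⟨hs, hf⟩, fun h => hp0 ((hp _).2 h)⟩
  have hd : ∀ {α : Type} [Finite α] (h : contDefRing L hX) (e : Fin m → α),
      (univ : Set K).DefinableFun L
        (fun v : α → K => extendZero (h : X → K) (fun i => v (e i))) :=
    fun h e => (definableFun_contDef h).relabel e
  refine DefinablePred.congr (P := fun v : Fin 1 → K => _) ?_ (fun v => key (v 0))
  refine .forall (.imp (.not (.eq (.proj L) (definableFun_const 0))) (.forall_tuple (.imp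
    (.forall_fin fun i => .not (.eq (.proj L) (definableFun_const 0))) (.exists_tuple
      (.and (.forall_fin fun i => definablePred_absLT (.sub (.proj L) (definableFun_const _))
        (.proj L)) (.and (hX.preimage_comp _) (.and
        (.not (.eq (hd _ _) (definableFun_const 0))) (.and (.eq (hd _ _) (definableFun_const 0))
        (definablePred_absLT (.sub (.mul (hd _ _) (.inv (hd _ _))) (.proj L)) (.proj L))))))))))

/-- A single function `u` codes both a neighbourhood of `p₀`, through its support, and a tolerance,
through its size. The topological condition thereby becomes a quantifier over ring elements. -/
theorem apply_mem_clusterSet_iff (f s g : contDefRing L hX) :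
    g p₀ ∈ clusterSet p₀ p f s ↔ ∀ u : contDefRing L hX, u p₀ ≠ 0 →
      ∃ x : X, x ≠ p₀ ∧ s x = 0 ∧ u x ≠ 0 ∧
        AbsLE (unitBall (K := K)) (f x / p x - g x) (u x) := by
  constructor
  · intro h u hu
    have hcont : ContinuousAt (fun w : K × K × K => (w.1 - w.2.1) / w.2.2) (g p₀, g p₀, u p₀) := by
      refine ContinuousAt.div₀ ?_ ?_ hu <;> fun_prop
    have hO : ∀ᶠ w : K × K × K in 𝓝 (g p₀, g p₀, u p₀), (w.1 - w.2.1) / w.2.2 ∈ unitBall (K := K) := by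
      refine hcont ?_
      simpa using unitBall_mem_nhds
    rw [nhds_prod_eq] at hO
    obtain ⟨P, hP, Q, hQ, hPQ⟩ := eventually_prod_iff.1 hO
    have hgu : Tendsto (fun x : X => (g x, u x)) (𝓝 p₀) (𝓝 (g p₀, u p₀)) :=
      ((continuous_contDef g).prodMk (continuous_contDef u)).continuousAt
    have hune : ∀ᶠ x in 𝓝 p₀, u x ≠ 0 :=
      (continuous_contDef u).continuousAt.eventually_ne hu
    obtain ⟨x, ⟨hx0, hs, hx⟩, hxu, hxQ⟩ :=
      ((mem_clusterSet_iff_frequently.1 h _ hP).and_eventually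
        (hune.and (hgu.eventually hQ))).exists
    exact ⟨x, hx0, hs, hxu, (absLE_iff_div hxu).2 (hPQ hx hxQ)⟩
  · intro h
    rw [mem_clusterSet_iff_frequently]
    intro N hN
    rw [frequently_iff]
    intro V hV
    have hadd : Tendsto (fun w : K × K => w.1 + w.2) (𝓝 (0, g p₀)) (𝓝 (g p₀)) := by
      have : Continuous fun w : K × K => w.1 + w.2 := by fun_prop
      simpa using this.tendsto (0, g p₀)
    have hN' := hadd hN
    rw [nhds_prod_eq] at hN'
    obtain ⟨P, hP, Q, hQ, hPQ⟩ := eventually_prod_iff.1 hN'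
    obtain ⟨ε, hε, hεP⟩ := exists_mul_unitBall_subset hP
    have hV' : V ∩ {x | Q (g x)} ∈ 𝓝 p₀ :=
      inter_mem hV ((continuous_contDef g).continuousAt.eventually hQ)
    rw [nhds_subtype] at hV'
    obtain ⟨W, hW, hWV⟩ := hV'
    obtain ⟨χ, hχc, hχd, hχ1, hχ0, hχO⟩ := exists_bump L hW
    -- The test function is `ε * χ`: it vanishes off `W`, and its values lie in `ε * O`.
    obtain ⟨u, hu⟩ := exists_contDef_of_definableFun hX ((definableFun_const ε).mul hχd)
      ((continuous_const.mul hχc).comp continuous_subtype_val)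
    obtain ⟨x, hx0, hs, hux, a, ha, hle⟩ := h u (by simpa [hu, hχ1] using hε)
    have hxW : (x : Fin m → K) ∈ W := by
      by_contra H
      exact hux (by simp [hu, hχ0 _ H])
    refine ⟨x, (hWV hxW).1, hx0, hs, ?_⟩
    have h1 := hεP _ (mul_mem_unitBall (hχO x) ha)
    rw [← mul_assoc, ← hu, ← hle] at h1
    simpa using hPQ h1 (hWV hxW).2

end Cluster

/-! ### Finite cluster sets from separated germs -/

section Germs

variable {L : FirstOrder.Language.{v, w}} {K : Type u} [Field K] [TopologicalSpace K]
  [OrderedOrValuedField K] [L.Structure K] [IsExpansion L K] {m : ℕ}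
  {X : Set (Fin m → K)} {hX : (univ : Set K).Definable L X}

theorem continuousAt_extendZero {K : Type u} [Field K] [TopologicalSpace K] {m : ℕ}
    {X U : Set (Fin m → K)} {g : U → K} (hg : Continuous g) {x : X}
    (hx : (x : Fin m → K) ∈ U) (hU : U ∈ 𝓝[X] (x : Fin m → K)) :
    ContinuousAt (fun y : X => extendZero g y) x := by
  have h1 : ContinuousOn (extendZero g) U := by
    rw [continuousOn_iff_continuous_domRestrict]
    convert hg using 1
    ext y
    exact extendZero_coe g y
  exact (continuousWithinAt_iff_continuousAt_domRestrict (extendZero g) x.2).1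
    ((h1 x hx).mono_of_mem_nhdsWithin hU)

/-- Points outside `O` have a neighbourhood missing the closed set `W`, and there `h` is zero. -/
theorem continuous_of_eq_zero_off {m : ℕ} {K : Type u} [Field K] [TopologicalSpace K]
    {X W O : Set (Fin m → K)} (hW : IsClosed W) (hWO : W ⊆ O) {h : X → K}
    (hc : ∀ x : X, (x : Fin m → K) ∈ O → ContinuousAt h x)
    (h0 : ∀ x : X, (x : Fin m → K) ∉ W → h x = 0) : Continuous h := by
  refine continuous_iff_continuousAt.2 fun x => ?_
  by_cases hx : (x : Fin m → K) ∈ O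
  · exact hc x hx
  · refine (continuousAt_const (y := (0 : K))).congr ?_
    have : ∀ᶠ y : X in 𝓝 x, (y : Fin m → K) ∉ W :=
      continuous_subtype_val.continuousAt.eventually (hW.isOpen_compl.mem_nhds fun H => hx (hWO H))
    exact this.mono fun y hy => (h0 y hy).symm

/-- Take `S = χ * ∏ sᵢ` and `F = χ * p * ∑ cᵢ * δᵢ`, where the cut-off `χ` extends the data from `U`
to `X`. On the zeros of `sᵢ` in `U` other than `p₀` the quotient `F / p` equals `χ * cᵢ`, which
tends to `cᵢ`. Near `p₀`, where `χ ≠ 0`, the zeros of `S` are those of the `sᵢ`. -/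
theorem exists_clusterSet_eq_range {p₀ : X} {p : contDefRing L hX}
    (hgerms : HasArbitrarilyManyGerms L X p₀) (hp : ∀ x : X, p x = 0 ↔ x = p₀)
    {k : ℕ} (hk : 2 ≤ k) (c : Fin k → K) :
    ∃ f s : contDefRing L hX, clusterSet p₀ p f s = range c := by
  obtain ⟨U, hUX, hUd, hU, s, hs, δ, hδ, -, hvan, hsep, hbd⟩ := hgerms k (by omega)
  obtain ⟨O, hO, hpO, hOU⟩ := mem_nhdsWithin.1 hU
  obtain ⟨W, ⟨hWp, hWc⟩, hWO⟩ := (closed_nhds_basis (p₀ : Fin m → K)).mem_iff.1 (hO.mem_nhds hpO)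
  obtain ⟨χ, hχc, hχd, hχ1, hχ0, -⟩ := exists_bump L hWp
  have hχX : Continuous fun x : X => χ x := hχc.comp continuous_subtype_val
  have hnhds : ∀ x : X, (x : Fin m → K) ∈ O → U ∈ 𝓝[X] (x : Fin m → K) := fun x hx =>
    mem_of_superset (inter_mem (mem_nhdsWithin_of_mem_nhds (hO.mem_nhds hx)) self_mem_nhdsWithin)
      hOU
  have hpt : (univ : Set K).Definable L {(p₀ : Fin m → K)} := by
    refine DefinablePred.congr (DefinablePred.forall_fin fun i =>
      DefinablePred.eq (DefinableFun.proj L (i := i))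
        (definableFun_const ((p₀ : Fin m → K) i))) fun v => ?_
    exact funext_iff
  have hUd' : (univ : Set K).Definable L (U \ {(p₀ : Fin m → K)}) := hUd.sdiff hpt
  obtain ⟨S, hS⟩ := exists_contDef_of_definableFun hX
    (G := fun x => χ x * ∏ i, extendZero (s i) x)
    (hχd.mul (DefinableFun.finset_prod _ fun i => (hs i).2.definableFun_extendZero hUd))
    (by
      refine continuous_of_eq_zero_off hWc hWO (fun x hx => ?_) (fun x hx => by simp [hχ0 _ hx])
      refine hχX.continuousAt.mul (tendsto_finsetProd _ fun i _ => ?_)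
      exact continuousAt_extendZero (hs i).1 (hOU ⟨hx, x.2⟩) (hnhds x hx))
  obtain ⟨F, hF⟩ := exists_contDef_of_definableFun hX
    (G := fun x => ∑ i, χ x * extendZero (p : X → K) x * c i * extendZero (δ i) x)
    (DefinableFun.finset_sum _ fun i => (((hχd.mul (definableFun_contDef p)).mul
      (definableFun_const _)).mul ((hδ i).2.definableFun_extendZero hUd')))
    (by
      refine continuous_of_eq_zero_off hWc hWO (fun x hx => ?_) (fun x hx => by simp [hχ0 _ hx])
      simp_rw [extendZero_coe]
      refine tendsto_finsetSum _ fun i _ => ?_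
      -- At `p₀` the function `δᵢ` need not have a limit, but it is bounded and `p` tends to `0`.
      by_cases hx0 : x = p₀
      · obtain ⟨r, hr⟩ := hbd i
        have h1 : Continuous fun y : X => χ y * p y * c i * r :=
          ((hχX.mul (continuous_contDef p)).mul continuous_const).mul continuous_const
        have h2 : Tendsto (fun y : X => χ y * p y * c i * r) (𝓝 x) (𝓝 0) := by
          have := h1.tendsto x
          simpa [(hp x).2 hx0] using this
        have h3 := tendsto_zero_of_absLE h2 (z := fun y : X =>
          χ y * p y * c i * extendZero (δ i) (y : Fin m → K)) (Eventually.of_forall fun y => by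
            by_cases hy : (y : Fin m → K) ∈ U \ {(p₀ : Fin m → K)}
            · obtain ⟨a, ha, e⟩ := hr ⟨y, hy⟩
              exact ⟨a, ha, by rw [extendZero_coe (δ i) ⟨y, hy⟩, e, mul_assoc _ r a]⟩
            · exact ⟨0, zero_mem_unitBall, by rw [extendZero_of_notMem _ hy]; simp⟩)
        simpa [(hp x).2 hx0] using h3
      · refine ((hχX.mul (continuous_contDef p)).mul continuous_const).continuousAt.mul ?_
        have hx0' : (x : Fin m → K) ≠ p₀ := fun H => hx0 (Subtype.ext H)
        refine continuousAt_extendZero (hδ i).1 ⟨hOU ⟨hx, x.2⟩, hx0'⟩ ?_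
        exact inter_mem (hnhds x hx) (mem_nhdsWithin_of_mem_nhds (isOpen_ne.mem_nhds hx0')))
  have hval : ∀ x : X, x ≠ p₀ → ∀ hxU : (x : Fin m → K) ∈ U, ∀ i, s i ⟨x, hxU⟩ = 0 →
      F x / p x = χ x * c i := by
    intro x hx0 hxU i hi
    have hx0' : (x : Fin m → K) ≠ p₀ := fun H => hx0 (Subtype.ext H)
    have hp0 : p x ≠ 0 := mt (hp x).1 hx0
    have hδ' : ∀ j, extendZero (δ j) (x : Fin m → K) = if j = i then 1 else 0 := by
      intro j
      rw [extendZero_coe (δ j) ⟨x, hxU, hx0'⟩]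
      split_ifs with hji
      · subst hji
        -- The condition `δⱼ = 1` on the zeros of `sⱼ` is stated for pairs of distinct indices only,
        -- hence the requirement `2 ≤ k`.
        have : Nontrivial (Fin k) := Fin.nontrivial_iff_two_le.2 hk
        obtain ⟨l, hl⟩ := exists_ne j
        exact (hsep j l hl.symm ⟨x, hxU, hx0'⟩).1 hi
      · exact (hsep j i hji ⟨x, hxU, hx0'⟩).2 hi
    rw [hF, div_eq_iff hp0]
    simp only [hδ', extendZero_coe]
    simp
    ring
  have hχn : Tendsto (fun x : X => χ x) (𝓝 p₀) (𝓝 1) := by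
    simpa [hχ1] using hχX.tendsto p₀
  have hχc' : ∀ i, Tendsto (fun x : X => χ x * c i) (𝓝 p₀) (𝓝 (c i)) := fun i => by
    simpa using hχn.mul_const (c i)
  refine ⟨F, S, Subset.antisymm (fun d hd => ?_) ?_⟩
  -- Near `p₀` each of the finitely many functions `χ * cᵢ` avoids a neighbourhood of `d`, whereas
  -- `F / p` takes one of their values at every zero of `S` other than `p₀`.
  · by_contra hdc
    have hsepd : ∀ i, ∃ N ∈ 𝓝 d, ∀ᶠ x in 𝓝 p₀, χ (x : X) * c i ∉ N := by
      intro i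
      obtain ⟨A, B, hA, hB, hdA, hcB, hAB⟩ := t2_separation (fun h => hdc ⟨i, h.symm⟩ : d ≠ c i)
      exact ⟨A, hA.mem_nhds hdA, ((hχc' i).eventually (hB.mem_nhds hcB)).mono
        fun x hx hxA => disjoint_left.1 hAB hxA hx⟩
    choose N hN hNx using hsepd
    have hev : ∀ᶠ x : X in 𝓝 p₀, (x : Fin m → K) ∈ O :=
      continuous_subtype_val.continuousAt.eventually (hO.mem_nhds hpO)
    obtain ⟨x, ⟨hx0, hSx, hxN⟩, hxO, hxχ, hxN'⟩ :=
      ((mem_clusterSet_iff_frequently.1 hd (⋂ i, N i) (iInter_mem.2 hN)).and_eventually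
        (hev.and ((hχn.eventually_ne one_ne_zero).and (eventually_all.2 hNx)))).exists
    have hxU : (x : Fin m → K) ∈ U := hOU ⟨hxO, x.2⟩
    rw [hS, mul_eq_zero, Finset.prod_eq_zero_iff] at hSx
    obtain ⟨i, -, hi⟩ := hSx.resolve_left hxχ
    rw [extendZero_coe (s i) ⟨x, hxU⟩] at hi
    rw [hval x hx0 hxU i hi] at hxN
    exact hxN' i (mem_iInter.1 hxN i)
  · rintro _ ⟨i, rfl⟩
    rw [mem_clusterSet_iff_frequently]
    intro N hN
    have h1 := mem_closure_iff_frequently.1 (hvan i).2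
    have h2 : ∃ᶠ x : X in 𝓝 p₀, x ≠ p₀ ∧ ∃ h : (x : Fin m → K) ∈ U, s i ⟨x, h⟩ = 0 := by
      rw [nhds_subtype, frequently_comap]
      refine h1.mono fun y ⟨hy0, hyU, hy⟩ => ⟨⟨y, hUX hyU⟩, rfl, ?_, hyU, hy⟩
      exact fun H => hy0 (congrArg Subtype.val H)
    refine (h2.and_eventually ((hχc' i).eventually hN)).mono ?_
    rintro x ⟨⟨hx0, hxU, hi⟩, hxN⟩
    refine ⟨hx0, ?_, ?_⟩
    · rw [hS, Finset.prod_eq_zero (Finset.mem_univ i), mul_zero]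
      rw [extendZero_coe (s i) ⟨x, hxU⟩, hi]
    · rw [hval x hx0 hxU i hi]
      exact hxN

end Germs

/-! ### First-order relations in the ring of continuous definable functions -/

section Relations

variable {L : FirstOrder.Language.{v, w}} {K : Type u} [Field K] [TopologicalSpace K]
  [OrderedOrValuedField K] [L.Structure K] [IsExpansion L K] {m : ℕ}
  {X : Set (Fin m → K)} {hX : (univ : Set K).Definable L X}

variable (hX) in
/-- The functions with values in the unit ball. -/
def unitFunctions : Set (contDefRing L hX) := {s | ∀ x : X, s x ∈ unitBall (K := K)}

/-- `a` and `b` agree at the unique zero of `p`. -/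
def EqAt (p a b : contDefRing L hX) : Prop := ¬ ∃ x y, x * (a - b) + y * p = 1

/-- `|a| ≤ |b|` at the unique zero of `p`. -/
def LEAt (p a b : contDefRing L hX) : Prop := ∃ q, q ∈ unitFunctions hX ∧ EqAt p a (b * q)

/-- The value of `g` at the zero of `p` is a cluster value of `f / p` along the zeros of `s`. -/
def Clusters (p f s g : contDefRing L hX) : Prop :=
  ∀ u, ¬ EqAt p u 0 → ∃ q, q ∈ unitFunctions hX ∧ ∃ l,
    ¬ ∃ a b c, a * s + b * (f - g * p - u * p * q) + c * (1 - l * (p * u)) = 1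

/-- The set of cluster values of `f / p` along the zeros of `s` is bounded and discrete. -/
def BoundedDiscrete (p f s : contDefRing L hX) : Prop :=
  (∃ r, ∀ g, Clusters p f s g → LEAt p g r) ∧
  ∀ g, Clusters p f s g → ∃ e, ¬ EqAt p e 0 ∧
    ∀ h, Clusters p f s h → ¬ LEAt p e (h - g) → EqAt p h g

/-- The value of `x` at the zero of `p` is a power of the value of `t`. -/
def IsPower (p t x : contDefRing L hX) : Prop :=
  ¬ EqAt p x 0 ∧ ∃ f s, BoundedDiscrete p f s ∧ Clusters p f s x ∧
    ∀ y, Clusters p f s y → EqAt p y 1 ∨ ∃ z, Clusters p f s z ∧ EqAt p (t * z) y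

/-- The value of `x` at the zero of `p` is an integral power of the value of `t`. -/
def IsIntPower (p t x : contDefRing L hX) : Prop :=
  IsPower p t x ∨ ∃ y, EqAt p (x * y) 1 ∧ IsPower p t y

/-- If `x` and `z` take the values `τ ^ a` and `τ ^ c` at the zero of `p`, where `τ` is the value
of `t`, then `a` is positive and `c` is the least common multiple of `a` and `a + 1`. -/
def IsLcmSucc (p t x z : contDefRing L hX) : Prop :=
  IsPower p t x ∧ ¬ EqAt p x 1 ∧ ¬ EqAt p z 1 ∧ IsPower p x z ∧ IsPower p (x * t) z ∧
    ∀ y, IsPower p x y → IsPower p (x * t) y → IsPower p z y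

/-- If `x` and `z` take the values `τ ^ a` and `τ ^ c` at the zero of `p`, where `τ` is the value
of `t`, then `c = a * (a + 1)`. -/
def IsMulSucc (p t x z : contDefRing L hX) : Prop :=
  (EqAt p x 1 ∧ EqAt p z 1) ∨ (EqAt p (x * t) 1 ∧ EqAt p z 1) ∨ IsLcmSucc p t x z ∨
    ∃ y, EqAt p (x * y * t) 1 ∧ IsLcmSucc p t y z

/-- Multiplication of exponents. -/
def IsExpMul (p t x y z : contDefRing L hX) : Prop :=
  ∃ a b c, IsMulSucc p t (x * y) a ∧ IsMulSucc p t x b ∧ IsMulSucc p t y c ∧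
    EqAt p a (b * c * z * z)

/-! ### First-order definability of these relations in `(C(X), B)`. -/

section Definability

variable {A : Set (contDefRing L hX)} {α : Type} {a b c d e : (α → contDefRing L hX) → contDefRing L hX}

theorem definableFun_ringPredSymbol {n : ℕ} (F : Language.ring.Functions n)
    {t : Fin n → (α → contDefRing L hX) → contDefRing L hX}
    (ht : ∀ i, A.DefinableFun ringPred (t i)) :
    A.DefinableFun ringPred
      (fun v => (Ring.compatibleRingOfRing (contDefRing L hX)).funMap F (fun i => t i v)) :=
  (DefinableFun.of_empty (DefinableFun.fun_symbol (L := ringPred) (M := contDefRing L hX) F)).subst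
    ht

theorem _root_.Set.DefinableFun.contDef_add (ha : A.DefinableFun ringPred a)
    (hb : A.DefinableFun ringPred b) : A.DefinableFun ringPred (fun v => a v + b v) :=
  definableFun_ringPredSymbol (t := ![a, b]) Ring.addFunc (by simp [Fin.forall_fin_two, ha, hb])

theorem _root_.Set.DefinableFun.contDef_mul (ha : A.DefinableFun ringPred a)
    (hb : A.DefinableFun ringPred b) : A.DefinableFun ringPred (fun v => a v * b v) :=
  definableFun_ringPredSymbol (t := ![a, b]) Ring.mulFunc (by simp [Fin.forall_fin_two, ha, hb])

theorem _root_.Set.DefinableFun.contDef_sub (ha : A.DefinableFun ringPred a)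
    (hb : A.DefinableFun ringPred b) : A.DefinableFun ringPred (fun v => a v - b v) := by
  simp_rw [sub_eq_add_neg]
  exact ha.contDef_add (definableFun_ringPredSymbol (t := ![b]) Ring.negFunc (by simp [hb]))

theorem definableFun_one : A.DefinableFun ringPred (fun _ : α → contDefRing L hX => 1) :=
  definableFun_ringPredSymbol (t := ![]) Ring.oneFunc (fun i => i.elim0)

theorem definableFun_zero : A.DefinableFun ringPred (fun _ : α → contDefRing L hX => 0) :=
  definableFun_ringPredSymbol (t := ![]) Ring.zeroFunc (fun i => i.elim0)

theorem definablePred_mem_unitFunctions (ha : A.DefinableFun ringPred a) :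
    DefinablePred ringPred A (fun v => a v ∈ unitFunctions hX) := by
  have h : DefinablePred ringPred A
      (fun v : Fin 1 → contDefRing L hX => v 0 ∈ unitFunctions hX) := by
    refine Set.Definable.mono (Set.empty_definable_iff.2
      ⟨Language.Relations.formula (L := ringPred) PredRel.pred (fun i => Language.Term.var i), ?_⟩)
      (empty_subset A)
    ext v
    exact Iff.rfl
  exact h.subst (t := fun _ => a) (fun _ => ha)

theorem definablePred_eqAt (ha : A.DefinableFun ringPred a) (hb : A.DefinableFun ringPred b)
    (hc : A.DefinableFun ringPred c) :
    DefinablePred ringPred A (fun v => EqAt (a v) (b v) (c v)) :=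
  .not (.exists (.exists (.eq (.contDef_add (.contDef_mul (.proj _)
    (.contDef_sub (hb.relabel _) (hc.relabel _))) (.contDef_mul (.proj _) (ha.relabel _)))
    definableFun_one)))

theorem definablePred_leAt (ha : A.DefinableFun ringPred a) (hb : A.DefinableFun ringPred b)
    (hc : A.DefinableFun ringPred c) :
    DefinablePred ringPred A (fun v => LEAt (a v) (b v) (c v)) :=
  .exists (.and (definablePred_mem_unitFunctions (.proj _))
    (definablePred_eqAt (ha.relabel _) (hb.relabel _) (.contDef_mul (hc.relabel _) (.proj _))))

theorem definablePred_clusters (ha : A.DefinableFun ringPred a) (hb : A.DefinableFun ringPred b)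
    (hc : A.DefinableFun ringPred c) (hd : A.DefinableFun ringPred d) :
    DefinablePred ringPred A (fun v => Clusters (a v) (b v) (c v) (d v)) :=
  .forall (.imp (.not (definablePred_eqAt (ha.relabel _) (.proj _) definableFun_zero))
    (.exists (.and (definablePred_mem_unitFunctions (.proj _)) (.exists (.not
      (.exists (.exists (.exists (.eq (.contDef_add (.contDef_add
        (.contDef_mul (.proj _) (hc.relabel _))
        (.contDef_mul (.proj _) (.contDef_sub
          (.contDef_sub (hb.relabel _) (.contDef_mul (hd.relabel _) (ha.relabel _)))
          (.contDef_mul (.contDef_mul (.proj _) (ha.relabel _)) (.proj _)))))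
        (.contDef_mul (.proj _) (.contDef_sub definableFun_one
          (.contDef_mul (.proj _) (.contDef_mul (ha.relabel _) (.proj _))))))
        definableFun_one)))))))))

theorem definablePred_boundedDiscrete (ha : A.DefinableFun ringPred a)
    (hb : A.DefinableFun ringPred b) (hc : A.DefinableFun ringPred c) :
    DefinablePred ringPred A (fun v => BoundedDiscrete (a v) (b v) (c v)) :=
  .and (.exists (.forall (.imp
      (definablePred_clusters (ha.relabel _) (hb.relabel _) (hc.relabel _) (.proj _))
      (definablePred_leAt (ha.relabel _) (.proj _) (.proj _)))))
    (.forall (.imp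
      (definablePred_clusters (ha.relabel _) (hb.relabel _) (hc.relabel _) (.proj _))
      (.exists (.and (.not (definablePred_eqAt (ha.relabel _) (.proj _) definableFun_zero))
        (.forall (.imp
          (definablePred_clusters (ha.relabel _) (hb.relabel _) (hc.relabel _) (.proj _))
          (.imp (.not (definablePred_leAt (ha.relabel _) (.proj _)
            (.contDef_sub (.proj _) (.proj _))))
            (definablePred_eqAt (ha.relabel _) (.proj _) (.proj _)))))))))

theorem definablePred_isPower (ha : A.DefinableFun ringPred a)
    (hb : A.DefinableFun ringPred b) (hc : A.DefinableFun ringPred c) :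
    DefinablePred ringPred A (fun v => IsPower (a v) (b v) (c v)) :=
  .and (.not (definablePred_eqAt ha hc definableFun_zero))
    (.exists (.exists (.and (definablePred_boundedDiscrete (ha.relabel _) (.proj _) (.proj _))
      (.and (definablePred_clusters (ha.relabel _) (.proj _) (.proj _) (hc.relabel _))
        (.forall (.imp (definablePred_clusters (ha.relabel _) (.proj _) (.proj _) (.proj _))
          (.or (definablePred_eqAt (ha.relabel _) (.proj _) definableFun_one)
            (.exists (.and
              (definablePred_clusters (ha.relabel _) (.proj _) (.proj _) (.proj _))
              (definablePred_eqAt (ha.relabel _) (.contDef_mul (hb.relabel _) (.proj _))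
                (.proj _)))))))))))

theorem definablePred_isIntPower (ha : A.DefinableFun ringPred a)
    (hb : A.DefinableFun ringPred b) (hc : A.DefinableFun ringPred c) :
    DefinablePred ringPred A (fun v => IsIntPower (a v) (b v) (c v)) :=
  .or (definablePred_isPower ha hb hc) (.exists (.and
    (definablePred_eqAt (ha.relabel _) (.contDef_mul (hc.relabel _) (.proj _)) definableFun_one)
    (definablePred_isPower (ha.relabel _) (hb.relabel _) (.proj _))))

theorem definablePred_isLcmSucc (ha : A.DefinableFun ringPred a)
    (hb : A.DefinableFun ringPred b) (hc : A.DefinableFun ringPred c)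
    (hd : A.DefinableFun ringPred d) :
    DefinablePred ringPred A (fun v => IsLcmSucc (a v) (b v) (c v) (d v)) :=
  .and (definablePred_isPower ha hb hc) (.and
    (.not (definablePred_eqAt ha hc definableFun_one)) (.and
    (.not (definablePred_eqAt ha hd definableFun_one)) (.and
    (definablePred_isPower ha hc hd) (.and
    (definablePred_isPower ha (.contDef_mul hc hb) hd)
    (.forall (.imp (definablePred_isPower (ha.relabel _) (hc.relabel _) (.proj _))
      (.imp (definablePred_isPower (ha.relabel _) (.contDef_mul (hc.relabel _) (hb.relabel _))
        (.proj _)) (definablePred_isPower (ha.relabel _) (hd.relabel _) (.proj _)))))))))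

theorem definablePred_isMulSucc (ha : A.DefinableFun ringPred a)
    (hb : A.DefinableFun ringPred b) (hc : A.DefinableFun ringPred c)
    (hd : A.DefinableFun ringPred d) :
    DefinablePred ringPred A (fun v => IsMulSucc (a v) (b v) (c v) (d v)) :=
  .or (.and (definablePred_eqAt ha hc definableFun_one)
      (definablePred_eqAt ha hd definableFun_one)) (.or
    (.and (definablePred_eqAt ha (.contDef_mul hc hb) definableFun_one)
      (definablePred_eqAt ha hd definableFun_one)) (.or
    (definablePred_isLcmSucc ha hb hc hd) (.exists (.and
      (definablePred_eqAt (ha.relabel _) (.contDef_mul (.contDef_mul (hc.relabel _) (.proj _))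
        (hb.relabel _)) definableFun_one)
      (definablePred_isLcmSucc (ha.relabel _) (hb.relabel _) (.proj _) (hd.relabel _))))))

theorem definablePred_isExpMul (ha : A.DefinableFun ringPred a)
    (hb : A.DefinableFun ringPred b) (hc : A.DefinableFun ringPred c)
    (hd : A.DefinableFun ringPred d) (he : A.DefinableFun ringPred e) :
    DefinablePred ringPred A (fun v => IsExpMul (a v) (b v) (c v) (d v) (e v)) :=
  .exists (.exists (.exists (.and
    (definablePred_isMulSucc (ha.relabel _) (hb.relabel _)
      (.contDef_mul (hc.relabel _) (hd.relabel _)) (.proj _)) (.and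
    (definablePred_isMulSucc (ha.relabel _) (hb.relabel _) (hc.relabel _) (.proj _)) (.and
    (definablePred_isMulSucc (ha.relabel _) (hb.relabel _) (hd.relabel _) (.proj _))
    (definablePred_eqAt (ha.relabel _) (.proj _) (.contDef_mul (.contDef_mul
      (.contDef_mul (.proj _) (.proj _)) (he.relabel _)) (he.relabel _))))))))

end Definability

end Relations

/-! ### Meaning of the first-order relations -/

section Semantics

variable {L : FirstOrder.Language.{v, w}} {K : Type u} [Field K] [TopologicalSpace K]
  [OrderedOrValuedField K] [L.Structure K] [IsExpansion L K] {m : ℕ}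
  {X : Set (Fin m → K)} {hX : (univ : Set K).Definable L X} {p₀ : X} {p : contDefRing L hX}

theorem eqAt_iff (hp : ∀ x : X, p x = 0 ↔ x = p₀) {a b : contDefRing L hX} :
    EqAt p a b ↔ a p₀ = b p₀ := by
  rw [EqAt, exists_eq_one_iff]
  simp only [hp, contDef_sub, sub_eq_zero]
  push Not
  exact ⟨fun ⟨x, hx, h⟩ => h ▸ hx, fun h => ⟨p₀, h, rfl⟩⟩

theorem leAt_iff (hp : ∀ x : X, p x = 0 ↔ x = p₀) {a b : contDefRing L hX} :
    LEAt p a b ↔ AbsLE (unitBall (K := K)) (a p₀) (b p₀) := by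
  constructor
  · rintro ⟨q, hq, h⟩
    exact ⟨q p₀, hq p₀, by simpa using (eqAt_iff hp).1 h⟩
  · rintro ⟨c, hc, h⟩
    obtain ⟨q, hq⟩ := exists_const hX c
    refine ⟨q, fun x => ?_, (eqAt_iff hp).2 ?_⟩
    · rw [hq]
      exact hc
    · rw [h, contDef_mul, hq]

/-- The negated unit-ideal condition provides a common zero `x`. There `1 - l * (p * u) = 0` forces
`p x` and `u x` to be nonzero, and the middle equation then reads `f / p - g = u * q` with `q x ∈
O`. Conversely, constants suffice for `q` and `l`. -/
theorem clusters_iff (hp : ∀ x : X, p x = 0 ↔ x = p₀) {f s g : contDefRing L hX} :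
    Clusters p f s g ↔ g p₀ ∈ clusterSet p₀ p f s := by
  rw [apply_mem_clusterSet_iff]
  refine forall_congr' fun u => imp_congr (not_congr (eqAt_iff hp)) ?_
  simp only [exists_eq_one_iff₃, not_forall, not_not]
  constructor
  · rintro ⟨q, hq, l, x, hs, hx, hl⟩
    have hpu : p x * u x ≠ 0 := by
      intro h
      simp [h] at hl
    have hp0 := left_ne_zero_of_mul hpu
    refine ⟨x, mt (hp x).2 hp0, hs, right_ne_zero_of_mul hpu, q x, hq x, ?_⟩
    have hx' : f x - g x * p x - u x * p x * q x = 0 := hx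
    field_simp
    linear_combination hx'
  · rintro ⟨x, hx0, hs, hux, a, ha, e⟩
    have hp0 : p x ≠ 0 := mt (hp x).1 hx0
    obtain ⟨q, hq⟩ := exists_const hX a
    obtain ⟨l, hl⟩ := exists_const hX (p x * u x)⁻¹
    refine ⟨q, fun y => by rw [hq]; exact ha, l, x, hs, ?_, ?_⟩
    · simp only [contDef_sub, contDef_mul, hq]
      field_simp at e
      linear_combination e
    · simp only [contDef_sub, contDef_mul, contDef_one, hl]
      field_simp
      simp

theorem forall_clusters_iff (hp : ∀ x : X, p x = 0 ↔ x = p₀) {f s : contDefRing L hX}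
    {P : K → Prop} : (∀ g : contDefRing L hX, Clusters p f s g → P (g p₀)) ↔
      ∀ c ∈ clusterSet p₀ p f s, P c := by
  constructor
  · intro h c hc
    obtain ⟨g, hg⟩ := exists_const hX c
    rw [← hg p₀] at hc ⊢
    exact h g ((clusters_iff hp).2 hc)
  · exact fun h g hg => h _ ((clusters_iff hp).1 hg)

variable (hX) in
theorem exists_contDef_apply_iff (x : X) {P : K → Prop} :
    (∃ g : contDefRing L hX, P (g x)) ↔ ∃ c, P c := by
  refine ⟨fun ⟨g, hg⟩ => ⟨_, hg⟩, fun ⟨c, hc⟩ => ?_⟩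
  obtain ⟨g, hg⟩ := exists_const hX c
  exact ⟨g, by rwa [hg]⟩

theorem isDiscrete_iff_absLT {S : Set K} : IsDiscrete S ↔ ∀ c ∈ S, ∃ ε : K, ε ≠ 0 ∧
    ∀ d ∈ S, AbsLT (unitBall (K := K)) (d - c) ε → d = c := by
  rw [isDiscrete_iff_forall_mem_exists_isOpen]
  refine forall₂_congr fun c hc => ?_
  constructor
  · rintro ⟨U, hU, hUS⟩
    have hcU : c ∈ U := (hUS.symm.subset (mem_singleton c)).1
    obtain ⟨ε, hε, h⟩ := (OrderedOrValuedField.nhds_hasBasis c).mem_iff.1 (hU.mem_nhds hcU)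
    exact ⟨ε, hε, fun d hd hlt => hUS.subset ⟨h hlt, hd⟩⟩
  · rintro ⟨ε, hε, h⟩
    obtain ⟨U, hU, hUo, hcU⟩ :=
      mem_nhds_iff.1 ((OrderedOrValuedField.nhds_hasBasis c).mem_of_mem hε)
    refine ⟨U, hUo, Subset.antisymm (fun d hd => h d hd.2 (hU hd.1)) ?_⟩
    exact singleton_subset_iff.2 ⟨hcU, hc⟩

theorem boundedDiscrete_iff (hp : ∀ x : X, p x = 0 ↔ x = p₀) {f s : contDefRing L hX} :
    BoundedDiscrete p f s ↔
      (∃ r : K, ∀ c ∈ clusterSet p₀ p f s, AbsLE (unitBall (K := K)) c r) ∧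
      IsDiscrete (clusterSet p₀ p f s) := by
  have h1 : ∀ g : contDefRing L hX, (∃ e : contDefRing L hX, ¬ EqAt p e 0 ∧
      ∀ h, Clusters p f s h → ¬ LEAt p e (h - g) → EqAt p h g) ↔
      ∃ ε : K, ε ≠ 0 ∧ ∀ d ∈ clusterSet p₀ p f s,
        AbsLT (unitBall (K := K)) (d - g p₀) ε → d = g p₀ := by
    intro g
    rw [← exists_contDef_apply_iff hX p₀]
    refine exists_congr fun e => and_congr (not_congr (eqAt_iff hp)) ?_
    rw [← forall_clusters_iff hp]
    simp only [leAt_iff hp, eqAt_iff hp]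
    rfl
  rw [BoundedDiscrete, isDiscrete_iff_absLT, ← forall_clusters_iff hp]
  refine and_congr ?_ ?_
  · rw [← exists_contDef_apply_iff hX p₀]
    refine exists_congr fun r => ?_
    rw [← forall_clusters_iff hp]
    simp only [leAt_iff hp]
  · simp only [h1]

theorem pow_mem_unitBall {t : K} (ht : t ∈ unitBall (K := K)) (n : ℕ) :
    t ^ n ∈ unitBall (K := K) := by
  induction n with
  | zero => simpa using one_mem_unitBall
  | succ n ih =>
    rw [pow_succ]
    exact mul_mem_unitBall ih ht

theorem mem_unitBall_of_absLT_one {t : K} (ht : AbsLT (unitBall (K := K)) t 1) :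
    t ∈ unitBall (K := K) := by
  obtain ⟨b, hb, e⟩ := absLE_of_not_absLE ht
  rw [e, one_mul]
  exact hb

theorem absLT_one_pow {t : K} (ht : AbsLT (unitBall (K := K)) t 1) :
    ∀ n : ℕ, n ≠ 0 → AbsLT (unitBall (K := K)) (t ^ n) 1 := by
  rintro n hn ⟨a, ha, e⟩
  obtain ⟨n, rfl⟩ := Nat.exists_eq_succ_of_ne_zero hn
  exact ht ⟨t ^ n * a, mul_mem_unitBall (pow_mem_unitBall (mem_unitBall_of_absLT_one ht) n) ha, by rw [e, pow_succ]; ring⟩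

theorem pow_ne_one_of_absLT_one {t : K} (ht : AbsLT (unitBall (K := K)) t 1) {n : ℕ}
    (hn : n ≠ 0) : t ^ n ≠ 1 := fun h =>
  absLT_one_pow ht n hn (by rw [h]; exact ⟨1, one_mem_unitBall, by simp⟩)

theorem zpow_injective_of_absLT_one {t : K} (ht0 : t ≠ 0)
    (ht : AbsLT (unitBall (K := K)) t 1) : Function.Injective fun n : ℤ => t ^ n := by
  have h1 : ∀ n : ℤ, t ^ n = 1 → n = 0 := by
    intro n hn
    by_contra h0
    refine pow_ne_one_of_absLT_one ht (Int.natAbs_ne_zero.2 h0) ?_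
    rcases Int.natAbs_eq n with h | h
    · rwa [h, zpow_natCast] at hn
    · rwa [h, zpow_neg, zpow_natCast, inv_eq_one] at hn
  intro a b hab
  have := h1 (a - b) (by
    rw [zpow_sub₀ ht0]
    exact div_eq_one_iff_eq (zpow_ne_zero _ ht0) |>.2 hab)
  omega

/-- Finiteness from (BFin) stops the repeated division by `t p₀`, and this can only happen at `1`.
Conversely, an initial segment of the powers is a finite set of the required kind. -/
theorem isPower_iff (hBFin : BFin L K) (hgerms : HasArbitrarilyManyGerms L X p₀)
    (hp : ∀ x : X, p x = 0 ↔ x = p₀) {t x : contDefRing L hX} (ht0 : t p₀ ≠ 0)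
    (ht : AbsLT (unitBall (K := K)) (t p₀) 1) :
    IsPower p t x ↔ ∃ n : ℕ, x p₀ = t p₀ ^ n := by
  simp only [IsPower, eqAt_iff hp, contDef_zero, contDef_one, contDef_mul, clusters_iff hp,
    boundedDiscrete_iff hp]
  constructor
  · rintro ⟨hx, f, s, ⟨hb, hd⟩, hxF, hF⟩
    by_contra! H
    have hfin := hBFin _ (definable_clusterSet hp f s) (isClosed_clusterSet f s) hb hd
    have hmem : ∀ n : ℕ, x p₀ / t p₀ ^ n ∈ clusterSet p₀ p f s := by
      intro n
      induction n with
      | zero => simpa using hxF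
      | succ n ih =>
        obtain ⟨g, hg⟩ := exists_const hX (x p₀ / t p₀ ^ n)
        rw [← hg p₀] at ih
        rcases hF g ih with h | ⟨z, hz, e⟩
        · rw [hg, div_eq_one_iff_eq (pow_ne_zero _ ht0)] at h
          exact absurd h (H n)
        · rw [hg] at e
          have : x p₀ / t p₀ ^ (n + 1) = z p₀ := by
            rw [pow_succ, ← div_div, ← e, mul_div_cancel_left₀ _ ht0]
          rw [this]
          exact hz
    refine Set.infinite_of_injective_forall_mem (fun a b hab => ?_) hmem hfin
    have hab' : x p₀ / t p₀ ^ a = x p₀ / t p₀ ^ b := hab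
    rw [div_eq_mul_inv, div_eq_mul_inv, mul_right_inj' hx, inv_inj] at hab'
    have := zpow_injective_of_absLT_one ht0 ht (a₁ := (a : ℤ)) (a₂ := (b : ℤ)) (by simpa using hab')
    exact_mod_cast this
  · rintro ⟨n, hn⟩
    -- The set is `{1, t, …, t ^ (n + 1)}`, with one power more than needed so that at least two
    -- germs are used even when `n = 0`.
    obtain ⟨f, s, hfs⟩ := exists_clusterSet_eq_range hgerms hp (k := n + 2) (by omega)
      (fun i => t p₀ ^ (i : ℕ))
    refine ⟨by rw [hn]; exact pow_ne_zero _ ht0, f, s, ⟨⟨1, ?_⟩, ?_⟩, ?_, ?_⟩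
    · rw [hfs]
      rintro _ ⟨i, rfl⟩
      exact ⟨_, pow_mem_unitBall (mem_unitBall_of_absLT_one ht) _, (one_mul _).symm⟩
    · rw [hfs]
      exact (finite_range _).isDiscrete
    · rw [hfs, hn]
      exact ⟨⟨n, by omega⟩, rfl⟩
    · intro y hy
      rw [hfs] at hy ⊢
      obtain ⟨⟨i, hi⟩, hy⟩ := hy
      rcases Nat.eq_zero_or_pos i with rfl | hi0
      · left
        rw [← hy]
        exact pow_zero _
      · right
        obtain ⟨z, hz⟩ := exists_const hX (t p₀ ^ (i - 1))
        refine ⟨z, ⟨⟨i - 1, by omega⟩, (hz _).symm⟩, ?_⟩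
        rw [hz, ← hy, mul_pow_sub_one hi0.ne']

/-! ### Arithmetic of exponents. -/

section Arithmetic

variable (hBFin : BFin L K) (hgerms : HasArbitrarilyManyGerms L X p₀)
    (hp : ∀ x : X, p x = 0 ↔ x = p₀) {t : contDefRing L hX} (ht0 : t p₀ ≠ 0)
    (ht : AbsLT (unitBall (K := K)) (t p₀) 1)

include hBFin hgerms hp ht0 ht

theorem isIntPower_iff {x : contDefRing L hX} :
    IsIntPower p t x ↔ ∃ n : ℤ, x p₀ = t p₀ ^ n := by
  simp only [IsIntPower, eqAt_iff hp, isPower_iff hBFin hgerms hp ht0 ht, contDef_mul, contDef_one]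
  constructor
  · rintro (⟨n, hn⟩ | ⟨y, hxy, n, hn⟩)
    · exact ⟨n, by simpa using hn⟩
    · refine ⟨-n, ?_⟩
      rw [hn] at hxy
      rw [zpow_neg, zpow_natCast]
      exact eq_inv_of_mul_eq_one_left hxy
  · rintro ⟨n, hn⟩
    obtain ⟨k, rfl | rfl⟩ := n.eq_nat_or_neg
    · exact Or.inl ⟨k, by simpa using hn⟩
    · right
      obtain ⟨y, hy⟩ := exists_const hX (t p₀ ^ k)
      refine ⟨y, ?_, k, hy _⟩
      rw [hn, hy, zpow_neg, zpow_natCast, inv_mul_cancel₀ (pow_ne_zero _ ht0)]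

/-- Expresses divisibility: for `n ≠ 0` the value `t ^ n` is again nonzero and smaller than `1`, so
it may serve as the base. -/
theorem isPower_pow_iff {x y : contDefRing L hX} {n : ℕ} (hn : n ≠ 0) (hx : x p₀ = t p₀ ^ n) :
    IsPower p x y ↔ ∃ k : ℕ, n ∣ k ∧ y p₀ = t p₀ ^ k := by
  rw [isPower_iff hBFin hgerms hp (by rw [hx]; exact pow_ne_zero _ ht0)
    (by rw [hx]; exact absLT_one_pow ht n hn), hx]
  constructor
  · rintro ⟨k, hk⟩
    exact ⟨n * k, dvd_mul_right _ _, by rw [hk, pow_mul]⟩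
  · rintro ⟨_, ⟨k, rfl⟩, hk⟩
    exact ⟨k, by rw [hk, pow_mul]⟩

/-- Coprimality of `a` and `a + 1` makes their product the least common multiple. The exponent `0`,
also a common multiple, is excluded for `z`, and the power formula is only understood for bases
other than `1`. -/
theorem isLcmSucc_iff {x z : contDefRing L hX} {a : ℤ} (hx : x p₀ = t p₀ ^ a) :
    IsLcmSucc p t x z ↔ 0 < a ∧ z p₀ = t p₀ ^ (a * (a + 1)) := by
  have hinj := zpow_injective_of_absLT_one ht0 ht
  have hinj' : ∀ i j : ℕ, t p₀ ^ i = t p₀ ^ j → i = j := fun i j h => by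
    exact_mod_cast hinj (a₁ := (i : ℤ)) (a₂ := (j : ℤ)) (by simpa using h)
  have hpos : ∀ n : ℕ, n ≠ 0 → x p₀ = t p₀ ^ n → (IsLcmSucc p t x z ↔
      z p₀ = t p₀ ^ (n * (n + 1))) := by
    intro n hn hx
    have hxt : (x * t) p₀ = t p₀ ^ (n + 1) := by rw [contDef_mul, hx, pow_succ]
    have hn1 : n * (n + 1) ≠ 0 := by positivity
    have hco : ∀ k, n ∣ k → n + 1 ∣ k → n * (n + 1) ∣ k := fun k =>
      Nat.Coprime.mul_dvd_of_dvd_of_dvd (by simp)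
    have hx1 : ¬ x p₀ = 1 := by
      rw [hx]
      exact pow_ne_one_of_absLT_one ht hn
    simp only [IsLcmSucc, eqAt_iff hp, contDef_one,
      isPower_pow_iff hBFin hgerms hp ht0 ht hn hx,
      isPower_pow_iff hBFin hgerms hp ht0 ht n.succ_ne_zero hxt]
    constructor
    · rintro ⟨-, -, hz1, ⟨i, hi, hzi⟩, ⟨j, hj, hzj⟩, hmin⟩
      obtain rfl : i = j := hinj' _ _ (hzi ▸ hzj)
      have hi0 : i ≠ 0 := by
        rintro rfl
        exact hz1 (by simpa using hzi)
      -- Testing minimality on the product itself gives `i ∣ n * (n + 1)`; coprimality gives the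
      -- reverse divisibility.
      obtain ⟨y, hy⟩ := exists_const hX (t p₀ ^ (n * (n + 1)))
      have h := hmin y ⟨_, dvd_mul_right _ _, hy _⟩ ⟨_, dvd_mul_left _ _, hy _⟩
      rw [isPower_pow_iff hBFin hgerms hp ht0 ht hi0 hzi] at h
      obtain ⟨k, hik, hyk⟩ := h
      rw [hy] at hyk
      obtain rfl := hinj' _ _ hyk
      rw [hzi, Nat.dvd_antisymm hik (hco i hi hj)]
    · intro hz
      refine ⟨(isPower_iff hBFin hgerms hp ht0 ht).2 ⟨n, hx⟩, hx1, ?_,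
        ⟨_, dvd_mul_right _ _, hz⟩, ⟨_, dvd_mul_left _ _, hz⟩, ?_⟩
      · rw [hz]
        exact pow_ne_one_of_absLT_one ht hn1
      · rintro y ⟨i, hi, hyi⟩ ⟨j, hj, hyj⟩
        obtain rfl : i = j := hinj' _ _ (hyi ▸ hyj)
        exact (isPower_pow_iff hBFin hgerms hp ht0 ht hn1 hz).2 ⟨i, hco i hi hj, hyi⟩
  by_cases ha : 0 < a
  · lift a to ℕ using ha.le
    rw [hpos a (by omega) (by simpa using hx), and_iff_right ha]
    exact_mod_cast Iff.rfl
  · refine iff_of_false (fun h => ?_) (fun h => ha h.1)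
    obtain ⟨n, hn⟩ := (isPower_iff hBFin hgerms hp ht0 ht).1 h.1
    have h1 := h.2.1
    rw [eqAt_iff hp, contDef_one, hn] at h1
    obtain rfl : a = n := hinj (by simpa [hx] using hn)
    obtain rfl : n = 0 := by omega
    simp at h1

/-- The expression `a * (a + 1)` is invariant under `a ↦ -1 - a`, which carries `a < -1` to positive
exponents. The remaining values `0` and `-1` give `0`. -/
theorem isMulSucc_iff {x z : contDefRing L hX} {a : ℤ} (hx : x p₀ = t p₀ ^ a) :
    IsMulSucc p t x z ↔ z p₀ = t p₀ ^ (a * (a + 1)) := by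
  have hinj := zpow_injective_of_absLT_one ht0 ht
  have hone : ∀ n : ℤ, t p₀ ^ n = 1 ↔ n = 0 := fun n =>
    ⟨fun h => hinj (by simpa using h), fun h => by simp [h]⟩
  have hxt : x p₀ * t p₀ = t p₀ ^ (a + 1) := by rw [hx, zpow_add_one₀ ht0]
  have h4 : (∃ y, EqAt p (x * y * t) 1 ∧ IsLcmSucc p t y z) ↔
      0 < -1 - a ∧ z p₀ = t p₀ ^ (a * (a + 1)) := by
    have hmul : ∀ c : K, x p₀ * c * t p₀ = 1 ↔ c = t p₀ ^ (-1 - a) := by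
      intro c
      have : x p₀ * c * t p₀ = t p₀ ^ (a + 1) * c := by rw [← hxt]; ring
      rw [this, show (-1 - a : ℤ) = -(a + 1) by ring, zpow_neg, mul_comm,
        mul_eq_one_iff_eq_inv₀ (zpow_ne_zero _ ht0)]
    have hexp : (-1 - a) * (-1 - a + 1) = a * (a + 1) := by ring
    simp only [eqAt_iff hp, contDef_mul, contDef_one, hmul]
    constructor
    · rintro ⟨y, hy, h⟩
      rwa [isLcmSucc_iff hBFin hgerms hp ht0 ht hy, hexp] at h
    · intro h
      obtain ⟨y, hy⟩ := exists_const hX (t p₀ ^ (-1 - a))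
      refine ⟨y, hy _, ?_⟩
      rwa [isLcmSucc_iff hBFin hgerms hp ht0 ht (hy _), hexp]
  rw [IsMulSucc, h4, isLcmSucc_iff hBFin hgerms hp ht0 ht hx]
  simp only [eqAt_iff hp, contDef_mul, contDef_one, hxt]
  simp only [hx, hone]
  constructor
  · rintro (⟨rfl, h⟩ | ⟨h', h⟩ | ⟨-, h⟩ | ⟨-, h⟩)
    · simpa using h
    · simpa [h'] using h
    · exact h
    · exact h
  · intro h
    rcases lt_trichotomy a 0 with h' | rfl | h'
    · rcases eq_or_ne (a + 1) 0 with h1 | h1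
      · exact Or.inr (Or.inl ⟨h1, by simpa [h1] using h⟩)
      · exact Or.inr (Or.inr (Or.inr ⟨by omega, h⟩))
    · exact Or.inl ⟨rfl, by simpa using h⟩
    · exact Or.inr (Or.inr (Or.inl ⟨h', h⟩))

theorem isExpMul_iff {x y z : contDefRing L hX} {a b c : ℤ} (hx : x p₀ = t p₀ ^ a)
    (hy : y p₀ = t p₀ ^ b) (hz : z p₀ = t p₀ ^ c) : IsExpMul p t x y z ↔ c = a * b := by
  have hinj := zpow_injective_of_absLT_one ht0 ht
  have hxy : (x * y) p₀ = t p₀ ^ (a + b) := by rw [contDef_mul, hx, hy, zpow_add₀ ht0]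
  simp only [IsExpMul, isMulSucc_iff hBFin hgerms hp ht0 ht hx,
    isMulSucc_iff hBFin hgerms hp ht0 ht hy, isMulSucc_iff hBFin hgerms hp ht0 ht hxy,
    eqAt_iff hp, contDef_mul, hz]
  have hprod : t p₀ ^ (a * (a + 1)) * t p₀ ^ (b * (b + 1)) * t p₀ ^ c * t p₀ ^ c =
      t p₀ ^ (a * (a + 1) + b * (b + 1) + c + c) := by
    simp only [zpow_add₀ ht0]
  constructor
  · rintro ⟨f, g, h, hf, hg, hh, e⟩
    rw [hf, hg, hh, hprod] at e
    have := hinj e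
    nlinarith
  · rintro rfl
    obtain ⟨f, hf⟩ := exists_const hX (t p₀ ^ ((a + b) * (a + b + 1)))
    obtain ⟨g, hg⟩ := exists_const hX (t p₀ ^ (a * (a + 1)))
    obtain ⟨h, hh⟩ := exists_const hX (t p₀ ^ (b * (b + 1)))
    refine ⟨f, g, h, hf _, hg _, hh _, ?_⟩
    rw [hf, hg, hh, hprod]
    congr 1
    ring

end Arithmetic

end Semantics

/-! ### The interpretation of the integers. -/

theorem mem_pullback_single {M : Type u} {N : Type v} {D : Set (Fin 1 → M)} {π : D → N} {n : ℕ}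
    {S : Set (Fin n → N)} {z : Fin n × Fin 1 → M} :
    z ∈ pullback π S ↔ ∃ h : ∀ i, (fun j => z (i, j)) ∈ D, (fun i => π ⟨_, h i⟩) ∈ S := by
  constructor
  · rintro ⟨d, hd, hS⟩
    have e : ∀ i, (fun j => z (i, j)) = (d i : Fin 1 → M) := fun i => funext (hd i)
    refine ⟨fun i => (e i).symm ▸ (d i).2, ?_⟩
    convert hS using 2 with i
    exact congrArg π (Subtype.ext (e _))
  · rintro ⟨h, hS⟩
    exact ⟨fun i => ⟨_, h i⟩, fun _ _ => rfl, hS⟩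

section Interpretation

variable {L : FirstOrder.Language.{v, w}} {K : Type u} [Field K] [TopologicalSpace K]
  [OrderedOrValuedField K] [L.Structure K] [IsExpansion L K] {m : ℕ}
  {X : Set (Fin m → K)} {hX : (univ : Set K).Definable L X}

theorem isInterpretable_int {p t : contDefRing L hX} {p₀ : X} (hBFin : BFin L K)
    (hgerms : HasArbitrarilyManyGerms L X p₀) (hp : ∀ x : X, p x = 0 ↔ x = p₀)
    (ht0 : t p₀ ≠ 0) (ht : AbsLT (unitBall (K := K)) (t p₀) 1) :
    IsInterpretable ringPred (contDefRing L hX) {p, t} Language.ring ℤ := by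
  have hinj := zpow_injective_of_absLT_one ht0 ht
  have hpd : ∀ {α : Type}, Set.DefinableFun ringPred {p, t} (fun _ : α → contDefRing L hX => p) :=
    fun {α} => Language.definableFun_const ringPred α (by simp)
  have htd : ∀ {α : Type}, Set.DefinableFun ringPred {p, t} (fun _ : α → contDefRing L hX => t) :=
    fun {α} => Language.definableFun_const ringPred α (by simp)
  let D : Set (Fin 1 → contDefRing L hX) := {d | IsIntPower p t (d 0)}
  have hD : ∀ d : D, ∃ n : ℤ, (d : Fin 1 → contDefRing L hX) 0 p₀ = t p₀ ^ n := fun d =>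
    (isIntPower_iff hBFin hgerms hp ht0 ht).1 d.2
  choose π hπ using hD
  -- Exponents are determined by the values at `p₀`, so a preimage under `π` is definable as soon as
  -- some definable relation expresses `S` on all tuples whose values are integral powers.
  have hpull : ∀ {n : ℕ} {S : Set (Fin n → ℤ)} {Q : (Fin n → contDefRing L hX) → Prop},
      DefinablePred ringPred {p, t} Q →
      (∀ (z : Fin n → contDefRing L hX) (a : Fin n → ℤ), (∀ i, z i p₀ = t p₀ ^ a i) →
        (a ∈ S ↔ Q z)) → Set.Definable {p, t} ringPred (pullback π S) := by
    intro n S Q hQ hSQ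
    refine DefinablePred.congr (DefinablePred.and (DefinablePred.forall_fin fun i =>
      definablePred_isIntPower hpd htd (.proj _ (i := (i, 0))))
      (hQ.subst (t := fun i z => z (i, 0)) fun i => .proj _)) fun z => ?_
    refine mem_pullback_single.trans ⟨?_, ?_⟩
    · rintro ⟨h, hS⟩
      exact ⟨h, (hSQ _ _ fun i => hπ ⟨_, h i⟩).1 hS⟩
    · rintro ⟨h, hz⟩
      exact ⟨h, (hSQ _ _ fun i => hπ ⟨_, h i⟩).2 hz⟩
  refine ⟨1, D, π, fun n => ?_, ?_, ?_, fun n f => ?_, fun n r => r.elim⟩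
  · obtain ⟨g, hg⟩ := exists_const hX (t p₀ ^ n)
    have hgD : (fun _ => g) ∈ D := (isIntPower_iff hBFin hgerms hp ht0 ht).2 ⟨n, hg p₀⟩
    exact ⟨⟨_, hgD⟩, hinj ((hπ ⟨_, hgD⟩).symm.trans (hg p₀))⟩
  · exact definablePred_isIntPower hpd htd (.proj _)
  · refine hpull (definablePred_eqAt hpd (.proj _ (i := 0)) (.proj _ (i := 1))) fun z a h => ?_
    rw [eqAt_iff hp, h, h]
    exact hinj.eq_iff.symm
  · cases f with
    | add =>
      refine hpull (definablePred_eqAt hpd (.proj _ (i := 2))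
        (.contDef_mul (.proj _ (i := 0)) (.proj _ (i := 1)))) fun z a h => ?_
      rw [eqAt_iff hp, contDef_mul, h, h, h, ← zpow_add₀ ht0]
      exact hinj.eq_iff.symm
    | mul =>
      refine hpull (definablePred_isExpMul hpd htd (.proj _ (i := 0)) (.proj _ (i := 1))
        (.proj _ (i := 2))) fun z a h => ?_
      rw [isExpMul_iff hBFin hgerms hp ht0 ht (h 0) (h 1) (h 2)]
      exact Iff.rfl
    | neg =>
      refine hpull (definablePred_eqAt hpd (.contDef_mul (.proj _ (i := 0)) (.proj _ (i := 1)))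
        definableFun_one) fun z a h => ?_
      rw [eqAt_iff hp, contDef_mul, contDef_one, h, h, ← zpow_add₀ ht0, ← zpow_zero (t p₀)]
      have hneg : a 1 = -a 0 ↔ a 0 + a 1 = 0 := by omega
      exact hneg.trans hinj.eq_iff.symm
    | zero =>
      refine hpull (definablePred_eqAt hpd (.proj _ (i := 0)) definableFun_one) fun z a h => ?_
      rw [eqAt_iff hp, contDef_one, h, ← zpow_zero (t p₀)]
      exact hinj.eq_iff.symm
    | one =>
      refine hpull (definablePred_eqAt hpd (.proj _ (i := 0)) htd) fun z a h => ?_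
      have hone : t p₀ ^ a 0 = t p₀ ↔ a 0 = 1 := by
        conv_lhs => rhs; rw [← zpow_one (t p₀)]
        exact hinj.eq_iff
      rw [eqAt_iff hp, h, hone]
      exact Iff.rfl

end Interpretation

end DefContFun

end

theorem corollary5p5 {K : Type u} [Field K] [TopologicalSpace K] [DefContFun.OrderedOrValuedField K]
    (L : FirstOrder.Language.{v, w}) [L.Structure K] [DefContFun.IsExpansion L K]
    (hBFin : DefContFun.BFin L K)
    (τ : K) (hτ0 : τ ≠ 0) (hτ1 : DefContFun.AbsLT DefContFun.OrderedOrValuedField.unitBall τ 1)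
    {m : ℕ} {X : Set (Fin m → K)} (hX : (Set.univ : Set K).Definable L X)
    (p₀ : X) (hgerms : DefContFun.HasArbitrarilyManyGerms L X p₀)
    (p τs : DefContFun.contDefRing L hX)
    (hp : ∀ x : X, (p : X → K) x = 0 ↔ x = p₀)
    (hτs : (τs : X → K) p₀ = τ) :
    DefContFun.IsInterpretable DefContFun.ringPred (DefContFun.contDefRing L hX) {p, τs}
      FirstOrder.Language.ring ℤ := by
  subst hτs
  exact DefContFun.isInterpretable_int hBFin hgerms hp hτ0 hτ1
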